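/- For integers $1\le r\le k\le p$ and reals $\lambda>0$, $\tau\ge 1$, let $\Theta_0(k,p,r,\lambda,\tau)$ be the set of matrices $\Sigma=V\,\mathrm{diag}(\lambda_1,\dots,\lambda_r)\,V'+I_p$ with $V\in\mathbb R^{p\times r}$, $V'V=I_r$, at most $k$ nonzero rows of $V$, and $\lambda/\tau\le\lambda_r\le\cdots\le\lambda_1\le\lambda$. Let $\Theta_1(k,p,r,\lambda)$ be the set defined in the same way with $0\le\lambda_r\le\cdots\le\lambda_1\le\lambda$ instead. For $\Sigma$ in one of these sets let $X_1,\dots,X_n$ be i.i.d. $N(0,\Sigma)$ in $\mathbb R^p$, and let $\mathsf E_\Sigma$ denote the corresponding expectation. Let $\|\cdot\|$ be the spectral norm and $a\wedge b=\min(a,b)$. There is an absolute constant $c>0$ such that for all integers $1\le r\le k\le p$ and $n\ge1$ and all real $\lambda>0$ the following holds. (1) Covariance estimation. If $k\ge 2$, then $$\inf_{\widetilde\Sigma}\sup_{\Sigma\in\Theta_1(k,p,r,\lambda)}\mathsf E_\Sigma\|\widetilde\Sigma-\Sigma\|^2\ \ge\ c\left[\left(\frac{(\lambda+1)k}{n}\log\frac{ep}{k}+\frac{\lambda^2r}{n}\right)\wedge\lambda^2\right].$$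 If $k=1$ (hence $r=1$), then $$\inf_{\widetilde\Sigma}\sup_{\Sigma\in\Theta_1(1,p,1,\lambda)}\mathsf E_\Sigma\|\widetilde\Sigma-\Sigma\|^2\ \ge\ c\left[\left(\frac{1}{n}\log(ep)+\frac{\lambda^2}{n}\right)\wedge\lambda^2\right].$$ The infima are over all measurable matrix-valued functions $\widetilde\Sigma$ of $X_1,\dots,X_n$. (2) Subspace estimation. For every $\tau\ge1$, $$\inf_{\widetilde V}\sup_{\Sigma\in\Theta_0(k,p,r,\lambda,\tau)}\mathsf E_\Sigma\|\widetilde V\widetilde V'-VV'\|^2\ \ge\ c\left[\frac{(\lambda+1)(k-r)}{n\lambda^2}\log\frac{e(p-r)}{k-r}\wedge1\right],$$ where the right-hand side is read as $0$ if $k=r$, $V$ is the matrix in a representation of $\Sigma$ as above ($VV'$ does not depend on the representation), and the infimum is over all estimators $\widetilde V$ based on $X_1,\dots,X_n$ with orthonormal columns (whose number may depend on the data) such that $\widetilde V\widetilde V'$ is measurable. -/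

import Mathlib

open MeasureTheory ProbabilityTheory
open scoped ENNReal Matrix

noncomputable section

namespace SpikedCov

/-- The spectral norm of a square real matrix: the operator norm for the Euclidean norm. -/
def specNorm {p : ℕ} (A : Matrix (Fin p) (Fin p) ℝ) : ℝ :=
  ‖Matrix.toEuclideanCLM (𝕜 := ℝ) A‖

/-- The row support of a `p × r` matrix: the indices of its nonzero rows. -/
def rowSupport {p r : ℕ} (V : Matrix (Fin p) (Fin r) ℝ) : Set (Fin p) :=
  {j | ∃ i, V j i ≠ 0}

/-- `S = V diag(Λ) Vᵀ + I` is a spiked covariance matrix, where `V` has orthonormal columns and at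
most `k` nonzero rows, and `lo ≤ Λ_r ≤ ⋯ ≤ Λ_1 ≤ hi`. -/
structure IsSpiked {p r : ℕ} (k : ℕ) (lo hi : ℝ) (V : Matrix (Fin p) (Fin r) ℝ)
    (Λ : Fin r → ℝ) (S : Matrix (Fin p) (Fin p) ℝ) : Prop where
  orthonormal : Vᵀ * V = 1
  sparse : (rowSupport V).ncard ≤ k
  ordered : Antitone Λ
  lower : ∀ i, lo ≤ Λ i
  upper : ∀ i, Λ i ≤ hi
  eq : S = V * Matrix.diagonal Λ * Vᵀ + 1

/-- The parameter space `Θ₀(k, p, r, lam, τ)`. -/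
def Theta0 (k p r : ℕ) (lam τ : ℝ) : Set (Matrix (Fin p) (Fin p) ℝ) :=
  {S | ∃ (V : Matrix (Fin p) (Fin r) ℝ) (Λ : Fin r → ℝ), IsSpiked k (lam / τ) lam V Λ S}

/-- The parameter space `Θ₁(k, p, r, lam)`: the spikes may be arbitrarily small or zero. -/
def Theta1 (k p r : ℕ) (lam : ℝ) : Set (Matrix (Fin p) (Fin p) ℝ) :=
  {S | ∃ (V : Matrix (Fin p) (Fin r) ℝ) (Λ : Fin r → ℝ), IsSpiked k 0 lam V Λ S}

/-- The data: `n` observations (the rows of the data matrix) in `ℝᵖ`. -/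
abbrev Data (n p : ℕ) : Type := Fin n → EuclideanSpace ℝ (Fin p)

/-- The law of the data: the rows are i.i.d. with distribution `N(0, S)`. -/
def dataLaw (n : ℕ) {p : ℕ} (S : Matrix (Fin p) (Fin p) ℝ) : Measure (Data n p) :=
  Measure.pi fun _ : Fin n => multivariateGaussian 0 S

/-- An estimator of the covariance matrix: any measurable matrix-valued function of the data. -/
structure CovEstimator (n p : ℕ) where
  /-- The estimate. -/
  est : Data n p → Matrix (Fin p) (Fin p) ℝ
  measurable_est : ∀ i j, Measurable fun x => est x i j

/-- An estimator of the principal subspace: for each data set a matrix with orthonormal columns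
(a basis of the estimated subspace, whose dimension may depend on the data and need not be the true
one) such that the associated projection matrix is a measurable function of the data. -/
structure SubspaceEstimator (n p : ℕ) where
  /-- The dimension of the estimated subspace. -/
  dim : Data n p → ℕ
  /-- An orthonormal basis of the estimated subspace. -/
  frame : (x : Data n p) → Matrix (Fin p) (Fin (dim x)) ℝ
  orthonormal : ∀ x, (frame x)ᵀ * frame x = 1
  measurable_proj : ∀ i j, Measurable fun x => (frame x * (frame x)ᵀ) i j

/-- The minimax risk `inf_T sup_{S ∈ Θ₁} E ‖T - S‖²` of covariance estimation. -/
def covMinimaxRisk (n k p r : ℕ) (lam : ℝ) : ℝ≥0∞ :=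
  ⨅ T : CovEstimator n p, ⨆ S ∈ Theta1 k p r lam,
    ∫⁻ x, ENNReal.ofReal (specNorm (T.est x - S) ^ 2) ∂(dataLaw n S)

/-- The minimax risk `inf_T sup_{S ∈ Θ₀} E ‖T Tᵀ - V Vᵀ‖²` of principal subspace estimation, where
`V` comes from any representation of `S` as a spiked matrix (for `0 < lam` all of them have the same
`V Vᵀ`, the projection onto the span of the eigenvectors with eigenvalue greater than one). -/
def subspaceMinimaxRisk (n k p r : ℕ) (lam τ : ℝ) : ℝ≥0∞ :=
  ⨅ T : SubspaceEstimator n p, ⨆ S ∈ Theta0 k p r lam τ,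
    ⨆ (V : Matrix (Fin p) (Fin r) ℝ) (Λ : Fin r → ℝ) (_ : IsSpiked k (lam / τ) lam V Λ S),
      ∫⁻ x, ENNReal.ofReal (specNorm (T.frame x * (T.frame x)ᵀ - V * Vᵀ) ^ 2) ∂(dataLaw n S)

end SpikedCov

end

noncomputable section

namespace SpikedCov

/-! Each lower bound exhibits finitely many Gaussian models that are too close in Kullback-Leibler
divergence to be told apart, while their targets are far apart in spectral norm. The statistical
core is `exists_sum_loss_ge`, a mixture of Fano and Assouad. The parameter is a word over a finite
alphabet `J`. If changing one letter costs divergence at most `log |J| / 5`, every letter is misread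
with average probability at least `1/10`, and the losses of the letters add up. The spectral norm
enters through a single column of the error, whose squared length it dominates.

Four families of covariance matrices are used. Scale: one axis spike of size `lam` or slightly less,
giving `(1 + lam)^2 / n`. Position: one small spike along an unknown axis, giving `log p / n`,
needed only for `k = 1`. Direction: the first frame vector has a fixed coordinate plus one small
signed unit vector in each of `d` blocks of length `m`, the other frame vectors being fixed axes.
The alphabet has `2 * m` letters, each letter shows up in the column of `V * Vᵀ` at the fixed
coordinate, and `d * log (2 * m)` is comparable to `d * log (e * q / d)` when `m = ⌊q / d⌋`. This
gives the subspace bound with `d = k - r`, and the sparse term of the covariance bound with one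
spike and `d = k - 1`. Shear: a full `r × r` block `G * Gᵀ`, where `G` is a scaled shear with sign
parameters. The divergence does not see the scale of `G` but the loss does, whence `lam^2 * r / n`
for `r ≥ 2` and `lam ≥ 1`. For `lam ≤ 1` this term is dominated by the sparse one, and for `r = 1`
the scale family supplies it. -/

/-- `P` has a log-density with respect to `Q` whose `P`-mean, the Kullback-Leibler divergence, is
at most `κ`. -/
def KLBound {Ω : Type*} [MeasurableSpace Ω] (P Q : Measure Ω) (κ : ℝ) : Prop :=
  ∃ l : Ω → ℝ, Measurable l ∧ P = Q.withDensity (fun x => ENNReal.ofReal (Real.exp (l x))) ∧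
    Integrable l P ∧ ∫ x, l x ∂P ≤ κ

/-! ### Kullback-Leibler bounds: Gibbs inequality and tensorization -/

section KL

variable {Ω : Type*} [MeasurableSpace Ω] {P Q : Measure Ω}

/-- The Gibbs variational inequality for multiples of an indicator function. -/
theorem KLBound.gibbs [IsProbabilityMeasure P] [IsProbabilityMeasure Q] {κ : ℝ}
    (h : KLBound P Q κ) {A : Set Ω} (hA : MeasurableSet A) (t a : ℝ) :
    t * P.real A - κ - a + 1 ≤ Real.exp (-a) * (1 + (Real.exp t - 1) * Q.real A) := by
  classical
  obtain ⟨l, hl, hPQ, hli, hlκ⟩ := h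
  set f : Ω → ℝ := A.indicator fun _ => t with hf
  set g : Ω → ℝ := fun x => Real.exp (-a) * (1 + A.indicator (fun _ => Real.exp t - 1) x) with hg
  have hexp : ∀ x, g x = Real.exp (-a) * Real.exp (f x) := by
    intro x
    by_cases hx : x ∈ A <;> simp [hg, hf, hx]
  have hgQ : Integrable g Q :=
    ((integrable_const _).add ((integrable_const _).indicator hA)).const_mul _
  have hint : ∫ x, g x ∂Q = Real.exp (-a) * (1 + (Real.exp t - 1) * Q.real A) := by
    rw [hg, integral_const_mul, integral_add (integrable_const _)
      ((integrable_const _).indicator hA), integral_indicator_const _ hA]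
    simp [mul_comm]
  have hmeas : Measurable fun x => (Real.exp (l x)).toNNReal := (hl.exp).real_toNNReal
  have hPQ' : P = Q.withDensity (fun x => ((Real.exp (l x)).toNNReal : ℝ≥0∞)) := hPQ
  have hsm : ∀ x, (Real.exp (l x)).toNNReal • (g x * Real.exp (-l x)) = g x := by
    intro x
    rw [NNReal.smul_def, Real.coe_toNNReal _ (Real.exp_pos _).le, smul_eq_mul, Real.exp_neg]
    field_simp
  have hgP : Integrable (fun x => g x * Real.exp (-l x)) P := by
    rw [hPQ', integrable_withDensity_iff_integrable_smul hmeas]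
    simpa only [hsm] using hgQ
  have hgPint : ∫ x, g x * Real.exp (-l x) ∂P = ∫ x, g x ∂Q := by
    rw [hPQ', integral_withDensity_eq_integral_smul hmeas]
    simp only [hsm]
  have hfi : Integrable f P := (integrable_const _).indicator hA
  have hlow : Integrable (fun x => f x - l x - a + 1) P :=
    ((hfi.sub hli).sub (integrable_const _)).add (integrable_const _)
  have hle : ∫ x, (f x - l x - a + 1) ∂P ≤ ∫ x, g x * Real.exp (-l x) ∂P := by
    refine integral_mono hlow hgP fun x => ?_
    -- The exponential lies above its tangent. Under `P`, the factor `exp (-l)` converts the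
    -- integral to one under `Q`. The free shift `a` stands in for the logarithm of the
    -- Donsker-Varadhan formula.
    have := Real.add_one_le_exp (f x - l x - a)
    simp only
    rw [hexp, ← Real.exp_add, ← Real.exp_add]
    refine this.trans (le_of_eq ?_)
    congr 1
    ring
  rw [hgPint, hint] at hle
  refine le_trans ?_ hle
  have e1 : ∫ x, (f x - l x - a + 1) ∂P = t * P.real A - (∫ x, l x ∂P) - a + 1 := by
    have h1 : Integrable (fun x => f x - l x) P := hfi.sub hli
    have h2 : Integrable (fun x => f x - l x - a) P := h1.sub (integrable_const _)
    rw [integral_add h2 (integrable_const _), integral_sub h1 (integrable_const _),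
      integral_sub hfi hli, hf, integral_indicator_const _ hA]
    simp [mul_comm]
  rw [e1]
  linarith

theorem KLBound.mono {κ κ' : ℝ} (h : KLBound P Q κ) (hκ : κ ≤ κ') : KLBound P Q κ' := by
  obtain ⟨l, h1, h2, h3, h4⟩ := h
  exact ⟨l, h1, h2, h3, h4.trans hκ⟩

/-- Kullback-Leibler divergences add up for independent observations. -/
theorem KLBound.pi [IsProbabilityMeasure P] [IsProbabilityMeasure Q] {κ : ℝ}
    (h : KLBound P Q κ) (n : ℕ) :
    KLBound (Measure.pi fun _ : Fin n => P) (Measure.pi fun _ : Fin n => Q) (n * κ) := by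
  classical
  obtain ⟨l, hl, hPQ, hli, hlκ⟩ := h
  have hm : ∀ i : Fin n, Measurable fun x : Fin n → Ω => l (x i) := fun i =>
    hl.comp (measurable_pi_apply i)
  have hi : ∀ i : Fin n, Integrable (fun x : Fin n → Ω => l (x i)) (Measure.pi fun _ => P) :=
    fun i => integrable_comp_eval (i := i) hli
  refine ⟨fun x => ∑ i, l (x i), Finset.measurable_sum _ fun i _ => hm i, ?_,
    integrable_finsetSum _ fun i _ => hi i, ?_⟩
  -- It suffices to test boxes, on which the integral of the product density factorizes by
  -- independence.
  · refine Measure.pi_eq fun s hs => ?_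
    have hP : ∀ i, P (s i) =
        ∫⁻ x, (s i).indicator (fun x => ENNReal.ofReal (Real.exp (l x))) x ∂Q := fun i => by
      rw [lintegral_indicator (hs i), hPQ, withDensity_apply _ (hs i)]
    have hmi : ∀ i, Measurable ((s i).indicator fun x => ENNReal.ofReal (Real.exp (l x))) :=
      fun i => hl.exp.ennreal_ofReal.indicator (hs i)
    have hind := iIndepFun_pi (μ := fun _ : Fin n => Q) fun i => (hmi i).aemeasurable
    have := lintegral_prod_eq_prod_lintegral_of_indepFun Finset.univ _ hind
      fun i => (hmi i).comp (measurable_pi_apply i)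
    have hev : ∀ i : Fin n, ∫⁻ x : Fin n → Ω,
        (s i).indicator (fun x => ENNReal.ofReal (Real.exp (l x))) (x i)
          ∂(Measure.pi fun _ => Q) = P (s i) := fun i => by
      rw [hP i]
      exact (measurePreserving_eval (fun _ : Fin n => Q) i).lintegral_comp (hmi i)
    simp only [hev] at this
    rw [← this, withDensity_apply _ (MeasurableSet.univ_pi hs),
      ← lintegral_indicator (MeasurableSet.univ_pi hs)]
    refine lintegral_congr fun x => ?_
    by_cases hx : x ∈ Set.univ.pi s
    · rw [Set.indicator_of_mem hx, Real.exp_sum,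
        ENNReal.ofReal_prod_of_nonneg fun i _ => (Real.exp_pos _).le]
      exact Finset.prod_congr rfl fun i _ =>
        (Set.indicator_of_mem (Set.mem_univ_pi.mp hx i)
          fun x => ENNReal.ofReal (Real.exp (l x))).symm
    · rw [Set.indicator_of_notMem hx]
      obtain ⟨i, hi⟩ : ∃ i, x i ∉ s i := by simpa [Set.mem_univ_pi] using hx
      exact (Finset.prod_eq_zero (Finset.mem_univ i) (Set.indicator_of_notMem hi _)).symm
  · rw [integral_finsetSum _ fun i _ => hi i]
    have : ∀ i : Fin n, ∫ x : Fin n → Ω, l (x i) ∂(Measure.pi fun _ => P) = ∫ x, l x ∂P :=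
      fun i => integral_comp_eval (μ := fun _ : Fin n => P) (i := i) hl.aestronglyMeasurable
    simp only [this, Finset.sum_const, Finset.card_univ, Fintype.card_fin, nsmul_eq_mul]
    exact mul_le_mul_of_nonneg_left hlκ (Nat.cast_nonneg _)

end KL

/-! ### The Fano-Assouad inequality -/

/-- Assouad's method with an arbitrary finite alphabet: if every coordinate of the parameter `θ`
is hard to identify in the sense of Fano's inequality, then the losses of the coordinates add up. -/
theorem exists_sum_loss_ge {Ω B J : Type*} [MeasurableSpace Ω] [Fintype B] [DecidableEq B]
    [Fintype J] (hJ : 2 ≤ Fintype.card J) (P : (B → J) → Measure Ω)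
    [∀ θ, IsProbabilityMeasure (P θ)] (l : B → J → Ω → ℝ) (hl : ∀ b j, Measurable (l b j))
    (hl0 : ∀ b j x, 0 ≤ l b j x) {η : ℝ} (hη : 0 ≤ η)
    (hsep : ∀ b x i j, l b i x < η → l b j x < η → i = j)
    (hKL : ∀ θ b j, KLBound (P θ) (P (Function.update θ b j)) (Real.log (Fintype.card J) / 5)) :
    ∃ θ, ENNReal.ofReal (Fintype.card B * η / 10) ≤
      ∫⁻ x, ENNReal.ofReal (∑ b, l b (θ b) x) ∂(P θ) := by
  classical
  set M : ℝ := (Fintype.card J : ℝ) with hM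
  have hM2 : (2 : ℝ) ≤ M := by rw [hM]; exact_mod_cast hJ
  have hlogM : 0 < Real.log M := Real.log_pos (by linarith)
  set A : B → J → Set Ω := fun b j => {x | l b j x < η} with hA
  have hAm : ∀ b j, MeasurableSet (A b j) := fun b j => measurableSet_lt (hl b j) measurable_const
  have hsum : ∀ (b : B) (θ : B → J), ∑ j, (P (Function.update θ b j)).real (A b j) ≤ 9 / 10 * M := by
    intro b θ
    obtain ⟨j₀⟩ : Nonempty J := Fintype.card_pos_iff.mp (by omega)
    set Q := P (Function.update θ b j₀)
    have hQ : ∑ j, Q.real (A b j) ≤ 1 := by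
      rw [← measureReal_biUnion_finset (fun i _ j _ hij => ?_) (fun j _ => hAm b j)]
      · exact measureReal_le_one
      · exact Set.disjoint_left.mpr fun x hx hx' => hij (hsep b x i j hx hx')
    have hg : ∀ j, 2 * Real.log M * (P (Function.update θ b j)).real (A b j) - Real.log M / 5
        - Real.log (M + 1) + 1 ≤ (M + 1)⁻¹ * (1 + (M ^ 2 - 1) * Q.real (A b j)) := by
      intro j
      have h := hKL (Function.update θ b j) b j₀
      rw [Function.update_idem] at h
      -- With `exp t = M ^ 2` and `exp a = M + 1`, the factor `M ^ 2 - 1` cancels against `M + 1`;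
      -- as the sets `A b j` are disjoint, the right sides then sum to at most `M`.
      have := h.gibbs (hAm b j) (2 * Real.log M) (Real.log (M + 1))
      rwa [Real.exp_neg, Real.exp_log (by linarith), two_mul (Real.log M), Real.exp_add,
        Real.exp_log (by linarith), ← two_mul, ← sq] at this
    have hs := Finset.sum_le_sum fun j (_ : j ∈ Finset.univ) => hg j
    simp only [Finset.sum_add_distrib, Finset.sum_sub_distrib, ← Finset.mul_sum, Finset.sum_const,
      Finset.card_univ, nsmul_eq_mul, ← hM] at hs
    have hr : (M + 1)⁻¹ * (M * 1 + (M ^ 2 - 1) * ∑ j, Q.real (A b j)) ≤ M := by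
      rw [inv_mul_le_iff₀ (by linarith)]
      nlinarith [mul_nonneg (by nlinarith : 0 ≤ M ^ 2 - 1) (sub_nonneg.mpr hQ)]
    -- Nearly sharp at `M = 2`. The error budget is `1/5 + 8/5 = 9/5`, and dividing by `t / log M =
    -- 2` leaves the success rate `9/10`.
    have hlog : Real.log (M + 1) ≤ 8 / 5 * Real.log M := by
      have h5 : (M + 1) ^ 5 ≤ M ^ 8 := by
        calc (M + 1) ^ 5 ≤ (3 / 2 * M) ^ 5 := by gcongr; linarith
          _ = 243 / 32 * M ^ 5 := by ring
          _ ≤ 2 ^ 3 * M ^ 5 := by gcongr; norm_num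
          _ ≤ M ^ 3 * M ^ 5 := by gcongr
          _ = M ^ 8 := by ring
      have := Real.log_le_log (by positivity) h5
      rw [Real.log_pow, Real.log_pow] at this
      push_cast at this
      linarith
    have : 2 * Real.log M * ∑ j, (P (Function.update θ b j)).real (A b j)
        ≤ 2 * Real.log M * (9 / 10 * M) := by
      have : M * Real.log (M + 1) ≤ M * (8 / 5 * Real.log M) := by gcongr
      linarith
    exact le_of_mul_le_mul_left this (by positivity)
  have hres : ∀ b : B, ∑ θ : B → J, (P θ).real (A b (θ b)) ≤
      9 / 10 * Fintype.card (B → J) := by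
    intro b
    have hM0 : 0 < M := by linarith
    -- Exchanging the letter at `b` with a spare letter is an involution, so averaging over all
    -- words also averages over the letter at `b`.
    have e : ∑ q : (B → J) × J, (P q.1).real (A b (q.1 b)) =
        ∑ q : (B → J) × J, (P (Function.update q.1 b q.2)).real (A b q.2) := by
      refine (Fintype.sum_equiv (⟨fun q => (Function.update q.1 b q.2, q.1 b),
        fun q => (Function.update q.1 b q.2, q.1 b), fun q => ?_, fun q => ?_⟩ :
          (B → J) × J ≃ (B → J) × J) _ _ fun q => ?_).symm <;> simp
    rw [Fintype.sum_prod_type, Fintype.sum_prod_type] at e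
    simp only [Finset.sum_const, Finset.card_univ, nsmul_eq_mul, ← hM, ← Finset.mul_sum] at e
    have := Finset.sum_le_sum fun θ (_ : θ ∈ Finset.univ) => hsum b θ
    rw [← e, Finset.sum_const, nsmul_eq_mul, Finset.card_univ] at this
    refine le_of_mul_le_mul_left (this.trans (le_of_eq ?_)) hM0
    ring
  obtain ⟨θ, -, hθ⟩ : ∃ θ ∈ (Finset.univ : Finset (B → J)),
      ∑ b, (P θ).real (A b (θ b)) ≤ 9 / 10 * Fintype.card B := by
    obtain ⟨j₀⟩ : Nonempty J := Fintype.card_pos_iff.mp (by omega)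
    refine Finset.exists_le_of_sum_le ⟨fun _ => j₀, Finset.mem_univ _⟩ ?_
    rw [Finset.sum_comm]
    refine (Finset.sum_le_sum fun b _ => hres b).trans (le_of_eq ?_)
    simp only [Finset.sum_const, Finset.card_univ, nsmul_eq_mul]
    ring
  refine ⟨θ, ?_⟩
  -- Markov's inequality on the event that the letter at `b` has loss at least `η`.
  have hlow : ∀ b, ENNReal.ofReal (η * (1 - (P θ).real (A b (θ b)))) ≤
      ∫⁻ x, ENNReal.ofReal (l b (θ b) x) ∂(P θ) := by
    intro b
    rw [← probReal_compl_eq_one_sub (hAm b (θ b)), ENNReal.ofReal_mul hη, ofReal_measureReal]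
    refine le_trans ?_ (mul_meas_ge_le_lintegral₀ (hl b (θ b)).ennreal_ofReal.aemeasurable
      (ENNReal.ofReal η))
    gcongr
    intro x hx
    simp only [hA, Set.mem_compl_iff, Set.mem_ofPred_eq, not_lt] at hx
    exact ENNReal.ofReal_le_ofReal hx
  simp only [ENNReal.ofReal_sum_of_nonneg fun b _ => hl0 b (θ b) _]
  rw [lintegral_finsetSum _ fun b _ => (hl b (θ b)).ennreal_ofReal]
  refine le_trans ?_ (Finset.sum_le_sum fun b _ => hlow b)
  rw [← ENNReal.ofReal_sum_of_nonneg fun b _ =>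
    mul_nonneg hη (sub_nonneg.mpr measureReal_le_one)]
  refine ENNReal.ofReal_le_ofReal ?_
  rw [← Finset.mul_sum, Finset.sum_sub_distrib, Finset.sum_const, Finset.card_univ, nsmul_eq_mul]
  nlinarith

/-! ### Gaussian densities and their divergence -/

section Gaussian

variable {p : ℕ}

open WithLp in
theorem stdGaussian_eq_withDensity :
    stdGaussian (EuclideanSpace ℝ (Fin p)) = (volume : Measure (EuclideanSpace ℝ (Fin p))).withDensity
      fun x => ENNReal.ofReal ((√(2 * Real.pi))⁻¹ ^ p * Real.exp (-‖x‖ ^ 2 / 2)) := by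
  have hpi : Measure.pi (fun _ : Fin p => gaussianReal 0 1) =
      (volume : Measure (Fin p → ℝ)).withDensity
        fun x => ENNReal.ofReal (∏ i, gaussianPDFReal 0 1 (x i)) := by
    refine Measure.pi_eq fun s hs => ?_
    have hi : ∀ i, Integrable ((s i).indicator (gaussianPDFReal 0 1)) :=
      fun i => (integrable_gaussianPDFReal 0 1).indicator (hs i)
    have h0 : ∀ i x, 0 ≤ (s i).indicator (gaussianPDFReal 0 1) x :=
      fun i => Set.indicator_nonneg fun x _ => gaussianPDFReal_nonneg 0 1 x
    have hg : ∀ i, gaussianReal 0 1 (s i) =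
        ENNReal.ofReal (∫ x, (s i).indicator (gaussianPDFReal 0 1) x) := fun i => by
      rw [gaussianReal_apply_eq_integral 0 one_ne_zero, integral_indicator (hs i)]
    simp only [hg]
    rw [← ENNReal.ofReal_prod_of_nonneg fun i _ => integral_nonneg (h0 i),
      ← integral_fintype_prod_volume_eq_prod, withDensity_apply _ (MeasurableSet.univ_pi hs),
      ← lintegral_indicator (MeasurableSet.univ_pi hs)]
    have hint : Integrable (fun x : Fin p → ℝ => ∏ i, (s i).indicator (gaussianPDFReal 0 1) (x i))
        volume := Integrable.fintype_prod hi
    rw [ofReal_integral_eq_lintegral_ofReal hint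
      (Filter.Eventually.of_forall fun x => Finset.prod_nonneg fun i _ => h0 i _)]
    refine lintegral_congr fun x => ?_
    by_cases hx : x ∈ Set.univ.pi s
    · rw [Set.indicator_of_mem hx]
      congr 1
      exact Finset.prod_congr rfl fun i _ =>
        (Set.indicator_of_mem (Set.mem_univ_pi.mp hx i) (gaussianPDFReal 0 1)).symm
    · rw [Set.indicator_of_notMem hx]
      obtain ⟨i, hi⟩ : ∃ i, x i ∉ s i := by simpa [Set.mem_univ_pi] using hx
      rw [Finset.prod_eq_zero (Finset.mem_univ i) (Set.indicator_of_notMem hi _),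
        ENNReal.ofReal_zero]
  rw [← map_pi_eq_stdGaussian, hpi]
  ext s hs
  rw [Measure.map_apply (by fun_prop) hs, withDensity_apply _ hs,
    withDensity_apply _ ((by fun_prop : Measurable (toLp 2 : (Fin p → ℝ) → _)) hs),
    ← (PiLp.volume_preserving_toLp (Fin p)).setLIntegral_comp_preimage hs (by fun_prop)]
  refine lintegral_congr fun x => ?_
  congr 1
  simp only [gaussianPDFReal, Finset.prod_mul_distrib, Finset.prod_const, Finset.card_univ,
    Fintype.card_fin, ← Real.exp_sum, EuclideanSpace.real_norm_sq_eq, NNReal.coe_one, mul_one,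
    sub_zero, ← Finset.sum_div, Finset.sum_neg_distrib]

/-- The density of the centred Gaussian distribution with covariance matrix `S`. -/
def gaussianDensity (S : Matrix (Fin p) (Fin p) ℝ) (x : EuclideanSpace ℝ (Fin p)) : ℝ :=
  (√(2 * Real.pi))⁻¹ ^ p * (√S.det)⁻¹ * Real.exp (-(x.ofLp ⬝ᵥ S⁻¹ *ᵥ x.ofLp) / 2)

theorem measurable_quadForm (S : Matrix (Fin p) (Fin p) ℝ) :
    Measurable fun x : EuclideanSpace ℝ (Fin p) => x.ofLp ⬝ᵥ S *ᵥ x.ofLp := by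
  simp only [Matrix.mulVec, dotProduct]
  fun_prop

theorem measurable_gaussianDensity (S : Matrix (Fin p) (Fin p) ℝ) :
    Measurable (gaussianDensity S) :=
  (((measurable_quadForm S⁻¹).neg.div_const 2).exp).const_mul _

-- The law is the image of the standard Gaussian under the square root of `S`, so this is a linear
-- change of variables with Jacobian `√(det S)`.
open scoped MatrixOrder in
theorem multivariateGaussian_eq_withDensity {S : Matrix (Fin p) (Fin p) ℝ} (hS : S.PosDef) :
    multivariateGaussian 0 S =
      volume.withDensity fun x => ENNReal.ofReal (gaussianDensity S x) := by
  set A := CFC.sqrt S with hA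
  have hAA : A * A = S := CFC.sqrt_mul_sqrt_self _ hS.posSemidef.nonneg
  have hAps : A.PosSemidef := Matrix.nonneg_iff_posSemidef.mp (CFC.sqrt_nonneg S)
  have hAsymm : Aᵀ = A := by
    have := hAps.isHermitian
    rwa [Matrix.IsHermitian, Matrix.conjTranspose_eq_transpose_of_trivial] at this
  have hdet : A.det * A.det = S.det := by rw [← Matrix.det_mul, hAA]
  have hdet0 : A.det ≠ 0 := fun h => hS.det_pos.ne' (by rw [← hdet, h, zero_mul])
  have habs : √S.det = |A.det| := by rw [← hdet, Real.sqrt_mul_self_eq_abs]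
  set T := Matrix.toEuclideanCLM (𝕜 := ℝ) A with hT
  have hTdet : LinearMap.det (T : EuclideanSpace ℝ (Fin p) →ₗ[ℝ] EuclideanSpace ℝ (Fin p)) =
      A.det := by
    rw [hT, Matrix.coe_toEuclideanCLM_eq_toEuclideanLin, Matrix.toEuclideanLin,
      Matrix.toLpLin_eq_toLin, LinearMap.det_toLin]
  have hmap : Measure.map T volume =
      ENNReal.ofReal |A.det⁻¹| • (volume : Measure (EuclideanSpace ℝ (Fin p))) := by
    have := Measure.map_linearMap_addHaar_eq_smul_addHaar
      (volume : Measure (EuclideanSpace ℝ (Fin p)))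
      (f := (T : EuclideanSpace ℝ (Fin p) →ₗ[ℝ] EuclideanSpace ℝ (Fin p)))
      (by rw [hTdet]; exact hdet0)
    rw [hTdet] at this
    exact this
  have hTm : Measurable T := T.continuous.measurable
  have hdens : ∀ y, gaussianDensity S (T y) =
      |A.det⁻¹| * ((√(2 * Real.pi))⁻¹ ^ p * Real.exp (-‖y‖ ^ 2 / 2)) := by
    intro y
    have hq : (T y).ofLp ⬝ᵥ S⁻¹ *ᵥ (T y).ofLp = ‖y‖ ^ 2 := by
      have hinv : Aᵀ * (S⁻¹ * A) = 1 := by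
        rw [hAsymm, ← hAA, Matrix.mul_inv_rev, Matrix.mul_assoc,
          Matrix.nonsing_inv_mul _ (isUnit_iff_ne_zero.mpr hdet0), Matrix.mul_one,
          Matrix.mul_nonsing_inv _ (isUnit_iff_ne_zero.mpr hdet0)]
      rw [hT, Matrix.ofLp_toEuclideanCLM, Matrix.mulVec_mulVec, ← Matrix.vecMul_transpose,
        ← Matrix.dotProduct_mulVec, Matrix.mulVec_mulVec, hinv, Matrix.one_mulVec,
        EuclideanSpace.real_norm_sq_eq]
      simp [dotProduct, sq]
    rw [gaussianDensity, hq, habs, abs_inv]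
    ring
  have hset : multivariateGaussian 0 S = Measure.map T (stdGaussian (EuclideanSpace ℝ (Fin p))) := by
    rw [multivariateGaussian]
    simp only [zero_add]
    rfl
  rw [hset, stdGaussian_eq_withDensity]
  ext s hs
  rw [Measure.map_apply hTm hs, withDensity_apply _ hs, withDensity_apply _ (hTm hs)]
  have hvol : (volume : Measure (EuclideanSpace ℝ (Fin p))) =
      ENNReal.ofReal |A.det| • Measure.map T volume := by
    rw [hmap, smul_smul, ← ENNReal.ofReal_mul (abs_nonneg _), ← abs_mul,
      mul_inv_cancel₀ hdet0, abs_one, ENNReal.ofReal_one, one_smul]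
  conv_rhs => rw [hvol]
  have hm : Measurable fun y => ENNReal.ofReal (gaussianDensity S (T y)) :=
    (measurable_gaussianDensity S).ennreal_ofReal.comp hTm
  rw [Measure.restrict_smul, lintegral_smul_measure, setLIntegral_map hs
    (measurable_gaussianDensity S).ennreal_ofReal hTm, smul_eq_mul, ← lintegral_const_mul _ hm]
  refine lintegral_congr fun y => ?_
  rw [hdens, ← ENNReal.ofReal_mul (abs_nonneg _), ← mul_assoc, ← abs_mul,
    mul_inv_cancel₀ hdet0, abs_one, one_mul]

theorem integrable_coord_mul (S : Matrix (Fin p) (Fin p) ℝ) (i j : Fin p) :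
    Integrable (fun x : EuclideanSpace ℝ (Fin p) => x i * x j) (multivariateGaussian 0 S) := by
  have h : ∀ i : Fin p, MemLp (fun x : EuclideanSpace ℝ (Fin p) => x i) 2
      (multivariateGaussian 0 S) := fun i =>
    IsGaussian.memLp_dual _ (EuclideanSpace.proj (𝕜 := ℝ) i) 2 (by simp)
  exact (h i).integrable_mul (h j)

theorem integral_coord_mul {S : Matrix (Fin p) (Fin p) ℝ} (hS : S.PosSemidef) (i j : Fin p) :
    ∫ x : EuclideanSpace ℝ (Fin p), x i * x j ∂(multivariateGaussian 0 S) = S i j := by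
  have hz : ∀ i : Fin p, ∫ x : EuclideanSpace ℝ (Fin p), x i ∂(multivariateGaussian 0 S) = 0 := by
    intro i
    have := (EuclideanSpace.proj (𝕜 := ℝ) i).integral_comp_id_comm
      (μ := multivariateGaussian 0 S) IsGaussian.integrable_id
    rw [integral_id_multivariateGaussian, map_zero] at this
    exact this
  have := covariance_eval_multivariateGaussian (μ := 0) hS i j
  simpa [covariance, hz] using this

theorem integrable_quadForm (S R : Matrix (Fin p) (Fin p) ℝ) :
    Integrable (fun x : EuclideanSpace ℝ (Fin p) => x.ofLp ⬝ᵥ R *ᵥ x.ofLp)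
      (multivariateGaussian 0 S) := by
  simp only [Matrix.mulVec, dotProduct, Finset.mul_sum]
  refine integrable_finsetSum _ fun i _ => integrable_finsetSum _ fun j _ => ?_
  refine ((integrable_coord_mul S i j).const_mul (R i j)).congr (.of_forall fun x => ?_)
  simp only
  ring

theorem integral_quadForm {S : Matrix (Fin p) (Fin p) ℝ} (hS : S.PosSemidef)
    (R : Matrix (Fin p) (Fin p) ℝ) :
    ∫ x : EuclideanSpace ℝ (Fin p), x.ofLp ⬝ᵥ R *ᵥ x.ofLp ∂(multivariateGaussian 0 S) =
      (R * S).trace := by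
  have e : ∀ x : EuclideanSpace ℝ (Fin p), x.ofLp ⬝ᵥ R *ᵥ x.ofLp =
      ∑ i, ∑ j, R i j * (x i * x j) := by
    intro x
    simp only [Matrix.mulVec, dotProduct, Finset.mul_sum]
    exact Finset.sum_congr rfl fun i _ => Finset.sum_congr rfl fun j _ => by ring
  have hi : ∀ i j, Integrable (fun x : EuclideanSpace ℝ (Fin p) => R i j * (x i * x j))
      (multivariateGaussian 0 S) := fun i j => (integrable_coord_mul S i j).const_mul (R i j)
  rw [integral_congr_ae (.of_forall e),
    integral_finsetSum _ fun i _ => integrable_finsetSum _ fun j _ => hi i j]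
  simp only [Matrix.trace, Matrix.diag, Matrix.mul_apply]
  refine Finset.sum_congr rfl fun i _ => ?_
  rw [integral_finsetSum _ fun j _ => hi i j]
  refine Finset.sum_congr rfl fun j _ => ?_
  have hsymm : S i j = S j i := by simpa using (hS.isHermitian.apply i j).symm
  rw [integral_const_mul, integral_coord_mul hS, hsymm]

/-- The log-density is a constant plus a difference of quadratic forms, and a form `R` has mean `tr
(R * S₁)`. The bound is in fact the exact divergence. -/
theorem klBound_multivariateGaussian {S₁ S₂ : Matrix (Fin p) (Fin p) ℝ} (h₁ : S₁.PosDef)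
    (h₂ : S₂.PosDef) :
    KLBound (multivariateGaussian 0 S₁) (multivariateGaussian 0 S₂)
      (((S₂⁻¹ * S₁).trace - p + Real.log S₂.det - Real.log S₁.det) / 2) := by
  set q : EuclideanSpace ℝ (Fin p) → ℝ := fun x =>
    (x.ofLp ⬝ᵥ S₂⁻¹ *ᵥ x.ofLp - x.ofLp ⬝ᵥ S₁⁻¹ *ᵥ x.ofLp) / 2 with hq
  have hqm : Measurable q := ((measurable_quadForm _).sub (measurable_quadForm _)).div_const _
  have hqi : Integrable q (multivariateGaussian 0 S₁) :=
    ((integrable_quadForm _ _).sub (integrable_quadForm _ _)).div_const _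
  have hlm : Measurable fun x => (Real.log S₂.det - Real.log S₁.det) / 2 + q x :=
    measurable_const.add hqm
  refine ⟨fun x => (Real.log S₂.det - Real.log S₁.det) / 2 + q x, hlm, ?_,
    (integrable_const _).add hqi, ?_⟩
  · rw [multivariateGaussian_eq_withDensity h₁, multivariateGaussian_eq_withDensity h₂,
      ← withDensity_mul _ (measurable_gaussianDensity S₂).ennreal_ofReal hlm.exp.ennreal_ofReal]
    congr 1
    ext x
    have hd₁ := h₁.det_pos
    have hd₂ := h₂.det_pos
    have hs₁ : (√S₁.det)⁻¹ = Real.exp (-(Real.log S₁.det / 2)) := by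
      rw [Real.exp_neg, ← Real.log_sqrt hd₁.le, Real.exp_log (Real.sqrt_pos.mpr hd₁)]
    have hs₂ : (√S₂.det)⁻¹ = Real.exp (-(Real.log S₂.det / 2)) := by
      rw [Real.exp_neg, ← Real.log_sqrt hd₂.le, Real.exp_log (Real.sqrt_pos.mpr hd₂)]
    rw [Pi.mul_apply, ← ENNReal.ofReal_mul' (Real.exp_pos _).le]
    congr 1
    rw [gaussianDensity, gaussianDensity, hs₁, hs₂]
    simp only [mul_assoc, ← Real.exp_add]
    congr 2
    ring
  · have hqint : ∫ x, q x ∂(multivariateGaussian 0 S₁) =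
        ((S₂⁻¹ * S₁).trace - (S₁⁻¹ * S₁).trace) / 2 := by
      rw [hq, integral_div, integral_sub (integrable_quadForm _ _) (integrable_quadForm _ _),
        integral_quadForm h₁.posSemidef, integral_quadForm h₁.posSemidef]
    rw [integral_add (integrable_const _) hqi, hqint,
      Matrix.nonsing_inv_mul _ (isUnit_iff_ne_zero.mpr h₁.det_pos.ne')]
    simp only [integral_const, probReal_univ, smul_eq_mul, one_mul, Matrix.trace_one,
      Fintype.card_fin]
    apply le_of_eq
    ring

/-- A bound for the Kullback-Leibler divergence between the data laws, where `R` is the inverse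
of the second covariance matrix. -/
theorem klBound_dataLaw {S₁ S₂ R : Matrix (Fin p) (Fin p) ℝ} (h₁ : S₁.PosDef)
    (h₂ : S₂.PosDef) (hR : R * S₂ = 1) (n : ℕ) {κ : ℝ}
    (hκ : n * (((R * S₁).trace - p + Real.log S₂.det - Real.log S₁.det) / 2) ≤ κ) :
    KLBound (dataLaw n S₁) (dataLaw n S₂) κ := by
  have h := (klBound_multivariateGaussian h₁ h₂).pi n
  rw [Matrix.inv_eq_left_inv hR] at h
  exact h.mono hκ

instance isProbabilityMeasure_dataLaw (n : ℕ) (S : Matrix (Fin p) (Fin p) ℝ) :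
    IsProbabilityMeasure (dataLaw n S) :=
  Measure.pi.instIsProbabilityMeasure _

end Gaussian

/-! ### Spectral norm against entries and columns -/

section SpecNorm

variable {p : ℕ}

theorem specNorm_nonneg (A : Matrix (Fin p) (Fin p) ℝ) : 0 ≤ specNorm A := norm_nonneg _

/-- The operator norm dominates the image of a basis vector. Controlling a whole column rather than
one entry is what lets the losses of several blocks add up. -/
theorem sum_sq_col_le_specNorm_sq (A : Matrix (Fin p) (Fin p) ℝ) (a : Fin p) :
    ∑ q, A q a ^ 2 ≤ specNorm A ^ 2 := by
  have h := (Matrix.toEuclideanCLM (𝕜 := ℝ) A).le_opNorm (EuclideanSpace.single a 1)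
  rw [PiLp.norm_single, norm_one, mul_one] at h
  have h2 := pow_le_pow_left₀ (norm_nonneg _) h 2
  rw [EuclideanSpace.real_norm_sq_eq] at h2
  simpa [specNorm, Matrix.ofLp_toEuclideanCLM] using h2

theorem sq_entry_le_specNorm_sq (A : Matrix (Fin p) (Fin p) ℝ) (i j : Fin p) :
    A i j ^ 2 ≤ specNorm A ^ 2 :=
  (Finset.single_le_sum (f := fun q => A q j ^ 2) (fun _ _ => sq_nonneg _)
    (Finset.mem_univ i)).trans (sum_sq_col_le_specNorm_sq A j)

theorem specNorm_sub_le (A B C : Matrix (Fin p) (Fin p) ℝ) :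
    specNorm (A - B) ≤ specNorm (C - A) + specNorm (C - B) := by
  simp only [specNorm, map_sub]
  rw [norm_sub_rev (Matrix.toEuclideanCLM (𝕜 := ℝ) C) (Matrix.toEuclideanCLM (𝕜 := ℝ) A)]
  exact norm_sub_le_norm_sub_add_norm_sub _ _ _

theorem specNorm_smul (c : ℝ) (A : Matrix (Fin p) (Fin p) ℝ) :
    specNorm (c • A) = |c| * specNorm A := by
  simp [specNorm, norm_smul]

theorem continuous_specNorm :
    Continuous (specNorm : Matrix (Fin p) (Fin p) ℝ → ℝ) :=
  (LinearMap.continuous_of_finiteDimensional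
    ((Matrix.toEuclideanCLM (n := Fin p) (𝕜 := ℝ)).toAlgEquiv.toLinearEquiv.toLinearMap)).norm

theorem measurable_specNorm_sub {Ω : Type*} [MeasurableSpace Ω]
    {T : Ω → Matrix (Fin p) (Fin p) ℝ} (hT : ∀ i j, Measurable fun x => T x i j)
    (A : Matrix (Fin p) (Fin p) ℝ) : Measurable fun x => specNorm (T x - A) := by
  have h1 : Measurable fun x => (fun i j => T x i j : Fin p → Fin p → ℝ) :=
    measurable_pi_lambda _ fun i => measurable_pi_lambda _ fun j => hT i j
  have h2 : Continuous fun B : Fin p → Fin p → ℝ => specNorm (Matrix.of B - A) :=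
    continuous_specNorm.comp ((continuous_id : Continuous fun B : Fin p → Fin p → ℝ => B).sub
      continuous_const)
  exact h2.measurable.comp h1

end SpecNorm

/-! ### From hypothesis families to spectral risk -/

section Reduction

variable {n p : ℕ}

/-- Fano's lower bound for the spectral risk over a finite separated family. -/
theorem exists_specNorm_risk_ge_of_separated {J : Type*} [Fintype J] (hJ : 2 ≤ Fintype.card J)
    (S : J → Matrix (Fin p) (Fin p) ℝ)
    (hKL : ∀ i j, KLBound (dataLaw n (S i)) (dataLaw n (S j)) (Real.log (Fintype.card J) / 5))
    {T : Data n p → Matrix (Fin p) (Fin p) ℝ} (hT : ∀ i j, Measurable fun x => T x i j)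
    {δ : ℝ} (hsep : ∀ i j, i ≠ j → δ ≤ specNorm (S i - S j) ^ 2) (hδ : 0 ≤ δ) :
    ∃ j, ENNReal.ofReal (δ / 40) ≤
      ∫⁻ x, ENNReal.ofReal (specNorm (T x - S j) ^ 2) ∂(dataLaw n (S j)) := by
  obtain ⟨θ, hθ⟩ := exists_sum_loss_ge (B := Unit) hJ (fun θ => dataLaw n (S (θ ())))
    (fun _ j x => specNorm (T x - S j) ^ 2)
    (fun _ j => (measurable_specNorm_sub hT (S j)).pow_const 2) (fun _ _ _ => sq_nonneg _)
    -- By the triangle inequality an estimate cannot be within squared distance `δ / 4` of two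
    -- targets at squared distance `δ`. Together with the factor `10` this gives `40`.
    (η := δ / 4) (by positivity) (fun _ x i j hi hj => by
      by_contra hij
      have h1 := hsep i j hij
      have h2 := specNorm_sub_le (S i) (S j) (T x)
      have h3 := specNorm_nonneg (S i - S j)
      nlinarith [sq_nonneg (specNorm (T x - S i) - specNorm (T x - S j))])
    (fun θ b j => hKL _ _)
  refine ⟨θ (), ?_⟩
  simp only [Fintype.card_unit, Finset.univ_unique, Finset.sum_singleton] at hθ
  convert hθ using 2
  push_cast
  ring

/-- Assouad's lower bound for the spectral risk: the entries of one column of the target matrix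
are grouped into blocks, each of which encodes one letter of the parameter. -/
theorem exists_specNorm_risk_ge_of_blocks {B J I : Type*} [Fintype B] [DecidableEq B] [Fintype J]
    [Fintype I] (hJ : 2 ≤ Fintype.card J) (S M : (B → J) → Matrix (Fin p) (Fin p) ℝ)
    (hKL : ∀ θ b j, KLBound (dataLaw n (S θ)) (dataLaw n (S (Function.update θ b j)))
      (Real.log (Fintype.card J) / 5))
    {T : Data n p → Matrix (Fin p) (Fin p) ℝ} (hT : ∀ i j, Measurable fun x => T x i j)
    {e : B × I → Fin p} (he : Function.Injective e) (a : Fin p) (g : J → I → ℝ)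
    (hM : ∀ θ b i, M θ (e (b, i)) a = g (θ b) i) {δ : ℝ} (hδ : 0 ≤ δ)
    (hsep : ∀ i j, i ≠ j → δ ≤ ∑ q, (g i q - g j q) ^ 2) :
    ∃ θ, ENNReal.ofReal (Fintype.card B * δ / 40) ≤
      ∫⁻ x, ENNReal.ofReal (specNorm (T x - M θ) ^ 2) ∂(dataLaw n (S θ)) := by
  obtain ⟨θ, hθ⟩ := exists_sum_loss_ge hJ (fun θ => dataLaw n (S θ))
    (fun b j x => ∑ q, (T x (e (b, q)) a - g j q) ^ 2)
    (fun b j => Finset.measurable_sum _ fun q _ => ((hT _ _).sub_const _).pow_const 2)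
    (fun _ _ _ => Finset.sum_nonneg fun _ _ => sq_nonneg _)
    (η := δ / 4) (by positivity) (fun b x i j hi hj => by
      by_contra hij
      have h1 := hsep i j hij
      have h2 : ∑ q, (g i q - g j q) ^ 2 ≤ ∑ q, (2 * (T x (e (b, q)) a - g i q) ^ 2 +
          2 * (T x (e (b, q)) a - g j q) ^ 2) := Finset.sum_le_sum fun q _ => by
        nlinarith [sq_nonneg ((T x (e (b, q)) a - g i q) + (T x (e (b, q)) a - g j q))]
      rw [Finset.sum_add_distrib, ← Finset.mul_sum, ← Finset.mul_sum] at h2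
      linarith)
    hKL
  refine ⟨θ, ?_⟩
  refine le_trans (le_of_eq ?_) (hθ.trans (lintegral_mono fun x => ENNReal.ofReal_le_ofReal ?_))
  · congr 1
    ring
  -- The blocks occupy disjoint rows of column `a`, so their losses sum to at most the squared
  -- length of that column of the error.
  · refine le_trans ?_ (sum_sq_col_le_specNorm_sq _ a)
    rw [← Fintype.sum_prod_type' fun b q => (T x (e (b, q)) a - g (θ b) q) ^ 2]
    calc ∑ q : B × I, (T x (e (q.1, q.2)) a - g (θ q.1) q.2) ^ 2
        = ∑ q : B × I, ((T x - M θ) (e q) a) ^ 2 := Finset.sum_congr rfl fun q _ => by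
          rw [Matrix.sub_apply, hM]
      _ = ∑ q ∈ Finset.univ.map ⟨e, he⟩, ((T x - M θ) q a) ^ 2 := by rw [Finset.sum_map]; rfl
      _ ≤ ∑ q, ((T x - M θ) q a) ^ 2 :=
        Finset.sum_le_sum_of_subset_of_nonneg (Finset.subset_univ _) fun _ _ _ => sq_nonneg _

theorem le_covMinimaxRisk {k r : ℕ} {lam : ℝ} {c : ℝ≥0∞}
    (h : ∀ T : CovEstimator n p, ∃ S ∈ Theta1 k p r lam,
      c ≤ ∫⁻ x, ENNReal.ofReal (specNorm (T.est x - S) ^ 2) ∂(dataLaw n S)) :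
    c ≤ covMinimaxRisk n k p r lam := by
  refine le_iInf fun T => ?_
  obtain ⟨S, hS, hc⟩ := h T
  exact hc.trans (le_iSup₂ (f := fun S (_ : S ∈ Theta1 k p r lam) =>
    ∫⁻ x, ENNReal.ofReal (specNorm (T.est x - S) ^ 2) ∂(dataLaw n S)) S hS)

end Reduction

/-! ### Divergence between spiked models -/

section Spiked

variable {n p r : ℕ}

theorem posDef_one_add_smul (V : Matrix (Fin p) (Fin r) ℝ) {μ : ℝ} (hμ : 0 ≤ μ) :
    (1 + μ • (V * Vᵀ)).PosDef := by
  have h := (Matrix.posSemidef_self_mul_conjTranspose V).smul hμ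
  rw [Matrix.conjTranspose_eq_transpose_of_trivial] at h
  exact Matrix.PosDef.one.add_posSemidef h

theorem det_one_add_smul {V : Matrix (Fin p) (Fin r) ℝ} (hV : Vᵀ * V = 1) (μ : ℝ) :
    (1 + μ • (V * Vᵀ)).det = (1 + μ) ^ r := by
  rw [← Matrix.smul_mul, Matrix.det_one_add_mul_comm, Matrix.mul_smul, hV,
    show (1 : Matrix (Fin r) (Fin r) ℝ) + μ • 1 = (1 + μ) • 1 by rw [add_smul, one_smul],
    Matrix.det_smul, Matrix.det_one, Fintype.card_fin, mul_one]

/-- `V * Vᵀ` is a projection, and on its range `(1 - μ / (1 + μ)) * (1 + μ) = 1`. -/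
theorem one_sub_smul_mul_one_add_smul {V : Matrix (Fin p) (Fin r) ℝ} (hV : Vᵀ * V = 1) {μ : ℝ}
    (hμ : 0 ≤ μ) : (1 - (μ / (1 + μ)) • (V * Vᵀ)) * (1 + μ • (V * Vᵀ)) = 1 := by
  have hP : V * Vᵀ * (V * Vᵀ) = V * Vᵀ := by
    rw [Matrix.mul_assoc, ← Matrix.mul_assoc Vᵀ, hV, Matrix.one_mul]
  rw [Matrix.sub_mul, Matrix.mul_add, Matrix.mul_add, Matrix.one_mul, Matrix.one_mul,
    Matrix.mul_one, Matrix.smul_mul, Matrix.mul_smul, hP, smul_smul, add_sub_assoc, ← add_smul,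
    ← sub_smul]
  have : μ - (μ / (1 + μ) + μ / (1 + μ) * μ) = 0 := by
    have : 1 + μ ≠ 0 := by positivity
    field_simp
    ring
  rw [this, zero_smul, add_zero]

theorem trace_mul_transpose {V : Matrix (Fin p) (Fin r) ℝ} (hV : Vᵀ * V = 1) :
    (V * Vᵀ).trace = r := by
  rw [Matrix.trace_mul_comm, hV, Matrix.trace_one, Fintype.card_fin]

theorem trace_spiked {V W : Matrix (Fin p) (Fin r) ℝ} (hV : Vᵀ * V = 1) (hW : Wᵀ * W = 1)
    (μ ν : ℝ) :
    ((1 - (ν / (1 + ν)) • (W * Wᵀ)) * (1 + μ • (V * Vᵀ))).trace =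
      p + μ * r - ν / (1 + ν) * r - ν / (1 + ν) * μ * ((W * Wᵀ) * (V * Vᵀ)).trace := by
  rw [Matrix.sub_mul, Matrix.mul_add, Matrix.mul_add, Matrix.one_mul, Matrix.one_mul,
    Matrix.mul_one, Matrix.smul_mul, Matrix.mul_smul, smul_smul]
  simp only [Matrix.trace_sub, Matrix.trace_add, Matrix.trace_smul, Matrix.trace_one,
    trace_mul_transpose hV, trace_mul_transpose hW, Fintype.card_fin, smul_eq_mul]
  ring

/-- With equal spikes the determinants cancel and only the trace remains; `r` minus the trace of the
product measures how far apart the two projections are. -/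
theorem klBound_spiked {V W : Matrix (Fin p) (Fin r) ℝ} (hV : Vᵀ * V = 1) (hW : Wᵀ * W = 1)
    {μ : ℝ} (hμ : 0 ≤ μ) {κ : ℝ}
    (hκ : n * (μ ^ 2 / (1 + μ) * (r - ((W * Wᵀ) * (V * Vᵀ)).trace) / 2) ≤ κ) :
    KLBound (dataLaw n (1 + μ • (V * Vᵀ))) (dataLaw n (1 + μ • (W * Wᵀ))) κ := by
  refine klBound_dataLaw (posDef_one_add_smul V hμ) (posDef_one_add_smul W hμ)
    (one_sub_smul_mul_one_add_smul hW hμ) n (le_trans (le_of_eq ?_) hκ)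
  rw [trace_spiked hV hW, det_one_add_smul hV, det_one_add_smul hW]
  have : 1 + μ ≠ 0 := by positivity
  field_simp
  ring

/-- The log-determinant difference is bounded by `log x ≤ x - 1`, which makes the bound symmetric in
`μ` and `ν`. -/
theorem klBound_scaled {V : Matrix (Fin p) (Fin 1) ℝ} (hV : Vᵀ * V = 1) {μ ν : ℝ} (hμ : 0 ≤ μ)
    (hν : 0 ≤ ν) {κ : ℝ} (hκ : n * ((μ - ν) ^ 2 / ((1 + μ) * (1 + ν)) / 2) ≤ κ) :
    KLBound (dataLaw n (1 + μ • (V * Vᵀ))) (dataLaw n (1 + ν • (V * Vᵀ))) κ := by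
  refine klBound_dataLaw (posDef_one_add_smul V hμ) (posDef_one_add_smul V hν)
    (one_sub_smul_mul_one_add_smul hV hν) n (le_trans ?_ hκ)
  have hP : V * Vᵀ * (V * Vᵀ) = V * Vᵀ := by
    rw [Matrix.mul_assoc, ← Matrix.mul_assoc Vᵀ, hV, Matrix.one_mul]
  rw [trace_spiked hV hV, det_one_add_smul hV, det_one_add_smul hV, hP, trace_mul_transpose hV,
    pow_one, pow_one, Nat.cast_one, mul_one, mul_one, mul_one]
  have h1 : 0 < 1 + μ := by positivity
  have h2 : 0 < 1 + ν := by positivity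
  have hlog : Real.log (1 + ν) - Real.log (1 + μ) ≤ (1 + ν) / (1 + μ) - 1 := by
    rw [← Real.log_div h2.ne' h1.ne']
    exact Real.log_le_sub_one_of_pos (by positivity)
  have e : (μ - ν) ^ 2 / ((1 + μ) * (1 + ν)) =
      (μ - ν / (1 + ν) - ν / (1 + ν) * μ) + ((1 + ν) / (1 + μ) - 1) := by
    field_simp
    ring
  rw [e]
  gcongr
  linarith

end Spiked

/-! ### Embedding small matrices along coordinates -/

section Embedding

variable {p : ℕ} {K ι : Type*} {e : K → Fin p}

/-- The matrix of the coordinate embedding `ℝᴷ → ℝᵖ` along `e`. -/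
def coordEmbed (e : K → Fin p) : Matrix (Fin p) K ℝ := (1 : Matrix (Fin p) (Fin p) ℝ).submatrix id e

theorem coordEmbed_transpose_mul_self [DecidableEq K] (he : Function.Injective e) :
    (coordEmbed e)ᵀ * coordEmbed e = 1 := by
  ext i j
  simp [coordEmbed, Matrix.mul_apply, Matrix.one_apply, he.eq_iff]

theorem coordEmbed_mul_apply_of_notMem [Fintype K] {W : Matrix K ι ℝ} {q : Fin p} (hq : q ∉ Set.range e)
    (l : ι) : (coordEmbed e * W) q l = 0 := by
  rw [Matrix.mul_apply]
  refine Finset.sum_eq_zero fun x _ => ?_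
  have : q ≠ e x := fun h => hq ⟨x, h.symm⟩
  simp [coordEmbed, this]

variable [Fintype K] [DecidableEq K]

theorem coordEmbed_mul_apply (he : Function.Injective e) (W : Matrix K ι ℝ) (x : K) (l : ι) :
    (coordEmbed e * W) (e x) l = W x l := by
  simp [coordEmbed, Matrix.mul_apply, Matrix.one_apply, he.eq_iff]

theorem transpose_mul_coordEmbed [Fintype ι] [DecidableEq ι] (he : Function.Injective e)
    {W : Matrix K ι ℝ} (hW : Wᵀ * W = 1) : (coordEmbed e * W)ᵀ * (coordEmbed e * W) = 1 := by
  rw [Matrix.transpose_mul, Matrix.mul_assoc, ← Matrix.mul_assoc _ᵀ (coordEmbed e),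
    coordEmbed_transpose_mul_self he, Matrix.one_mul, hW]

theorem rowSupport_coordEmbed_mul_subset {r : ℕ} (he : Function.Injective e)
    (W : Matrix K (Fin r) ℝ) :
    rowSupport (coordEmbed e * W) ⊆ e '' {x | ∃ l, W x l ≠ 0} := by
  rintro q ⟨l, hl⟩
  by_cases hq : q ∈ Set.range e
  · obtain ⟨x, rfl⟩ := hq
    exact ⟨x, ⟨l, by rwa [coordEmbed_mul_apply he] at hl⟩, rfl⟩
  · exact absurd (coordEmbed_mul_apply_of_notMem hq l) hl

theorem ncard_rowSupport_coordEmbed_mul_le {r : ℕ} (he : Function.Injective e)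
    (W : Matrix K (Fin r) ℝ) :
    (rowSupport (coordEmbed e * W)).ncard ≤ {x | ∃ l, W x l ≠ 0}.ncard :=
  (Set.ncard_le_ncard (rowSupport_coordEmbed_mul_subset he W) (Set.toFinite _)).trans
    (Set.ncard_image_le (Set.toFinite _))

/-- The block extension of a matrix by the identity. -/
def extendOne (e : K → Fin p) (G : Matrix K K ℝ) : Matrix (Fin p) (Fin p) ℝ :=
  1 + coordEmbed e * (G - 1) * (coordEmbed e)ᵀ

theorem extendOne_one : extendOne e 1 = 1 := by simp [extendOne]

/-- The embedding is isometric, so block extension is multiplicative. Inverses, traces and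
determinants can then be computed in the small block. -/
theorem extendOne_mul (he : Function.Injective e) (G H : Matrix K K ℝ) :
    extendOne e G * extendOne e H = extendOne e (G * H) := by
  have h : coordEmbed e * (G - 1) * (coordEmbed e)ᵀ * (coordEmbed e * (H - 1) * (coordEmbed e)ᵀ) =
      coordEmbed e * ((G - 1) * (H - 1)) * (coordEmbed e)ᵀ := by
    simp only [Matrix.mul_assoc]
    rw [← Matrix.mul_assoc _ᵀ (coordEmbed e), coordEmbed_transpose_mul_self he, Matrix.one_mul]
  have h2 : G * H - 1 = (H - 1) + ((G - 1) + (G - 1) * (H - 1)) := by noncomm_ring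
  rw [extendOne, extendOne, extendOne, h2, Matrix.add_mul, Matrix.one_mul, Matrix.mul_add,
    Matrix.mul_one, h]
  simp only [Matrix.mul_add, Matrix.add_mul]
  abel

theorem trace_extendOne (he : Function.Injective e) (G : Matrix K K ℝ) :
    (extendOne e G).trace = p + G.trace - Fintype.card K := by
  rw [extendOne, Matrix.trace_add, Matrix.trace_mul_comm, ← Matrix.mul_assoc,
    coordEmbed_transpose_mul_self he, Matrix.one_mul, Matrix.trace_sub, Matrix.trace_one,
    Matrix.trace_one, Fintype.card_fin]
  ring

theorem det_extendOne (he : Function.Injective e) (G : Matrix K K ℝ) :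
    (extendOne e G).det = G.det := by
  rw [extendOne, Matrix.mul_assoc, Matrix.det_one_add_mul_comm, Matrix.mul_assoc,
    coordEmbed_transpose_mul_self he, Matrix.mul_one, add_sub_cancel]

theorem extendOne_apply_of_ne (he : Function.Injective e) (G : Matrix K K ℝ) {i j : K}
    (hij : i ≠ j) : extendOne e G (e i) (e j) = G i j := by
  rw [extendOne, Matrix.add_apply, Matrix.mul_assoc, coordEmbed_mul_apply he,
    ← Matrix.transpose_apply ((G - 1) * _), Matrix.transpose_mul, Matrix.transpose_transpose,
    coordEmbed_mul_apply he, Matrix.transpose_apply, Matrix.sub_apply, Matrix.one_apply_ne hij,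
    Matrix.one_apply_ne (he.ne hij)]
  ring

theorem posDef_extendOne {G : Matrix K K ℝ} (hG : (G - 1).PosSemidef) :
    (extendOne e G).PosDef := by
  have h := hG.mul_mul_conjTranspose_same (coordEmbed e)
  rw [Matrix.conjTranspose_eq_transpose_of_trivial] at h
  exact Matrix.PosDef.one.add_posSemidef h

end Embedding

/-! ### Membership in the parameter space -/

section Membership

variable {p k r : ℕ} {lam : ℝ}

/-- Spikes in `Theta1` may vanish. Inside a set of `k` coordinates containing the support, the unit
vector extends to `r` orthonormal vectors, and the added ones receive spike zero. -/
theorem one_add_smul_mem_Theta1 {V : Matrix (Fin p) (Fin 1) ℝ} (hV : Vᵀ * V = 1)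
    (hsupp : (rowSupport V).ncard ≤ k) (hr : 1 ≤ r) (hrk : r ≤ k) (hkp : k ≤ p) {μ : ℝ}
    (hμ : 0 ≤ μ) (hμl : μ ≤ lam) : 1 + μ • (V * Vᵀ) ∈ Theta1 k p r lam := by
  classical
  obtain ⟨K, hVK, hK⟩ : ∃ K : Finset (Fin p), (rowSupport V).toFinset ⊆ K ∧ K.card = k := by
    refine Finset.exists_superset_card_eq ?_ (by simpa using hkp)
    rwa [← Set.ncard_eq_toFinset_card']
  set e : Fin k → Fin p := ⇑(K.orderEmbOfFin hK)
  have he : Function.Injective e := (K.orderEmbOfFin hK).injective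
  have hzero : ∀ q, q ∉ Set.range e → V q 0 = 0 := by
    intro q hq
    by_contra h
    refine hq ?_
    rw [show Set.range e = K from Finset.range_orderEmbOfFin K hK]
    exact hVK (Set.mem_toFinset.mpr ⟨0, h⟩)
  have hcol : ∑ q, V q 0 ^ 2 = 1 := by
    have := congrFun (congrFun hV 0) 0
    simpa [Matrix.mul_apply, sq] using this
  have hcol' : ∑ x, V (e x) 0 ^ 2 = 1 := by
    rw [← hcol]
    refine (Finset.sum_map Finset.univ ⟨e, he⟩ fun q => V q 0 ^ 2).symm.trans ?_
    refine Finset.sum_subset (Finset.subset_univ _) fun q _ hq => ?_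
    rw [hzero q fun ⟨x, hx⟩ => hq (by simpa using ⟨x, hx⟩), zero_pow two_ne_zero]
  set y : EuclideanSpace ℝ (Fin k) := WithLp.toLp 2 fun x => V (e x) 0
  have hy : ‖y‖ = 1 := by
    rw [← sq_eq_sq₀ (norm_nonneg _) zero_le_one, EuclideanSpace.real_norm_sq_eq, one_pow]
    exact hcol'
  set z : Fin k := ⟨0, by omega⟩
  have horth : Orthonormal ℝ (({z} : Set (Fin k)).domRestrict fun _ => y) := by
    refine ⟨fun _ => hy, fun i j hij => absurd (Subsingleton.elim i j) hij⟩
  obtain ⟨b, hb⟩ := horth.exists_orthonormalBasis_extension_of_card_eq (by simp)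
  have hbz : b z = y := hb z rfl
  set B : Matrix (Fin k) (Fin r) ℝ := Matrix.of fun x l => b (Fin.castLE hrk l) x
  have hB : Bᵀ * B = 1 := by
    ext i j
    have := orthonormal_iff_ite.mp b.orthonormal (Fin.castLE hrk j) (Fin.castLE hrk i)
    simp only [PiLp.inner_apply, RCLike.inner_apply, conj_trivial] at this
    rw [Matrix.mul_apply, Matrix.one_apply]
    simpa [B, eq_comm] using this
  set U := coordEmbed e * B
  set l₀ : Fin r := ⟨0, by omega⟩
  have hU : ∀ q, U q l₀ = V q 0 := by
    intro q
    by_cases hq : q ∈ Set.range e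
    · obtain ⟨x, rfl⟩ := hq
      refine (coordEmbed_mul_apply he B x l₀).trans ?_
      change b z x = _
      rw [hbz]
    · rw [hzero q hq]
      exact coordEmbed_mul_apply_of_notMem hq l₀
  refine ⟨U, fun l => if l = l₀ then μ else 0, transpose_mul_coordEmbed he hB, ?_, ?_, ?_, ?_, ?_⟩
  · refine (ncard_rowSupport_coordEmbed_mul_le he B).trans ((Set.ncard_le_card _).trans ?_)
    simp
  · intro i j hij
    by_cases hj : j = l₀
    · have hi : i = l₀ := le_antisymm (hj ▸ hij) (Fin.mk_le_mk.mpr (Nat.zero_le _))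
      simp [hi, hj]
    · simp only [hj, if_false]
      split_ifs <;> linarith
  · intro i
    split_ifs <;> linarith
  · intro i
    split_ifs <;> linarith
  · rw [add_comm]
    congr 1
    ext i j
    rw [Matrix.mul_apply, Finset.sum_eq_single l₀]
    · rw [Matrix.mul_diagonal, if_pos rfl, Matrix.transpose_apply, hU, hU, Matrix.smul_apply,
        Matrix.mul_apply, Fin.sum_univ_one, Matrix.transpose_apply, smul_eq_mul]
      ring
    · intro l _ hl
      rw [Matrix.mul_diagonal, if_neg hl, mul_zero, zero_mul]
    · simp

/-- The spikes are the eigenvalues of `H - 1` in decreasing order; evaluating the quadratic form at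
eigenvectors places them in `[0, lam]`. -/
theorem extendOne_mem_Theta1 {e : Fin r → Fin p} (he : Function.Injective e) (hrk : r ≤ k)
    {H : Matrix (Fin r) (Fin r) ℝ} (hH : (H - 1).IsHermitian)
    (hlow : ∀ x, x ⬝ᵥ x ≤ x ⬝ᵥ H *ᵥ x) (hup : ∀ x, x ⬝ᵥ H *ᵥ x ≤ (1 + lam) * (x ⬝ᵥ x)) :
    extendOne e H ∈ Theta1 k p r lam := by
  set f := hH.eigenvalues
  set U : Matrix (Fin r) (Fin r) ℝ := hH.eigenvectorUnitary.1
  have hUU : Uᵀ * U = 1 := by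
    have := Unitary.coe_star_mul_self hH.eigenvectorUnitary
    rwa [Matrix.star_eq_conjTranspose, Matrix.conjTranspose_eq_transpose_of_trivial] at this
  have hspec : H - 1 = U * Matrix.diagonal f * Uᵀ := by
    have := hH.spectral_theorem
    rw [Unitary.conjStarAlgAut_apply, Matrix.star_eq_conjTranspose,
      Matrix.conjTranspose_eq_transpose_of_trivial] at this
    exact this
  have hval : ∀ i, ∃ x : Fin r → ℝ, x ⬝ᵥ x = 1 ∧ f i = x ⬝ᵥ H *ᵥ x - 1 := by
    intro i
    have h1 : (hH.eigenvectorBasis i).ofLp ⬝ᵥ (hH.eigenvectorBasis i).ofLp = 1 := by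
      have := hH.eigenvectorBasis.orthonormal.1 i
      rw [← sq_eq_sq₀ (norm_nonneg _) zero_le_one, EuclideanSpace.real_norm_sq_eq, one_pow] at this
      simpa [dotProduct, sq] using this
    refine ⟨(hH.eigenvectorBasis i).ofLp, h1, ?_⟩
    have h2 := hH.mulVec_eigenvectorBasis i
    have h3 := congrArg (fun v => (hH.eigenvectorBasis i).ofLp ⬝ᵥ v) h2
    simp only [Matrix.sub_mulVec, Matrix.one_mulVec, dotProduct_sub, dotProduct_smul, h1,
      smul_eq_mul, mul_one] at h3
    exact h3.symm
  set τ : Equiv.Perm (Fin r) := Tuple.sort fun i => -f i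
  have hanti : Antitone (f ∘ τ) := by
    intro i j hij
    have := Tuple.monotone_sort (fun i => -f i) hij
    simpa using this
  refine ⟨coordEmbed e * U.submatrix id τ, f ∘ τ, transpose_mul_coordEmbed he ?_, ?_, hanti,
    ?_, ?_, ?_⟩
  · rw [Matrix.transpose_submatrix, ← Matrix.submatrix_mul _ _ _ _ _ Function.bijective_id, hUU,
      Matrix.submatrix_one_equiv]
  · refine (ncard_rowSupport_coordEmbed_mul_le he _).trans ((Set.ncard_le_card _).trans ?_)
    simpa using hrk
  · intro i
    obtain ⟨x, hx, hfx⟩ := hval (τ i)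
    have := hlow x
    simp only [Function.comp_apply, hfx]
    linarith
  · intro i
    obtain ⟨x, hx, hfx⟩ := hval (τ i)
    have := hup x
    rw [hx] at this
    simp only [Function.comp_apply, hfx]
    linarith
  · have hd : U.submatrix id τ * Matrix.diagonal (f ∘ τ) * (U.submatrix id τ)ᵀ = H - 1 := by
      rw [hspec, ← Matrix.submatrix_diagonal_equiv, Matrix.submatrix_mul_equiv,
        Matrix.transpose_submatrix, Matrix.submatrix_mul_equiv]
      rfl
    rw [extendOne, add_comm, Matrix.transpose_mul, ← hd]
    simp only [Matrix.mul_assoc]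

end Membership

/-! ### Axis spikes: scale and position -/

section TwoPoint

variable {p : ℕ}

/-- The `p × 1` matrix whose only column is the `j`-th standard basis vector. -/
def unitCol (j : Fin p) : Matrix (Fin p) (Fin 1) ℝ := Matrix.of fun q _ => if q = j then 1 else 0

theorem unitCol_orthonormal (j : Fin p) : (unitCol j)ᵀ * unitCol j = 1 := by
  ext a b
  obtain rfl := Subsingleton.elim a b
  simp [unitCol, Matrix.mul_apply]

theorem unitCol_mul_transpose_apply (j a b : Fin p) :
    (unitCol j * (unitCol j)ᵀ) a b = if a = j ∧ b = j then 1 else 0 := by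
  simp only [unitCol, Matrix.mul_apply, Finset.univ_unique, Matrix.of_apply,
    Matrix.transpose_apply, Finset.sum_singleton]
  by_cases ha : a = j <;> by_cases hb : b = j <;> simp [ha, hb]

theorem ncard_rowSupport_unitCol (j : Fin p) : (rowSupport (unitCol j)).ncard ≤ 1 := by
  refine (Set.ncard_le_ncard (t := {j}) ?_).trans (Set.ncard_singleton j).le
  rintro q ⟨i, hi⟩
  by_contra h
  exact hi (by simpa [unitCol] using h)

/-- By cyclicity of the trace, the divergence between spiked models depends on the frames only
through their Gram matrix. -/
theorem trace_mul_mul_transpose {r : ℕ} (V W : Matrix (Fin p) (Fin r) ℝ) :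
    ((W * Wᵀ) * (V * Vᵀ)).trace = ∑ i, ∑ j, (Wᵀ * V) i j ^ 2 := by
  rw [Matrix.mul_assoc, Matrix.trace_mul_comm, ← Matrix.mul_assoc, Matrix.mul_assoc,
    show Vᵀ * W = (Wᵀ * V)ᵀ by rw [Matrix.transpose_mul, Matrix.transpose_transpose]]
  simp only [Matrix.trace, Matrix.diag, Matrix.mul_apply (M := Wᵀ * V), Matrix.transpose_apply, sq]

/-- Estimating the size of a single spike. -/
theorem covMinimaxRisk_ge_scale {n k r : ℕ} {lam : ℝ} (hr : 1 ≤ r) (hrk : r ≤ k) (hkp : k ≤ p)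
    (hn : 1 ≤ n) (hlam : 0 < lam) :
    ENNReal.ofReal (1 / 360 * min ((1 + lam) ^ 2 / n) (lam ^ 2)) ≤ covMinimaxRisk n k p r lam := by
  have hn0 : (0 : ℝ) < n := by exact_mod_cast hn
  set w : ℝ := min ((1 + lam) ^ 2 / n) (lam ^ 2) with hw
  have hw0 : 0 ≤ w := le_min (by positivity) (by positivity)
  -- The divisor `3` gives `δ ≤ lam / 3`, so both variances stay above `2/3 * (1 + lam)`, and the
  -- total divergence is at most `1/8 < log 2 / 5`.
  set δ : ℝ := √w / 3 with hδ
  have hδ0 : 0 ≤ δ := by positivity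
  have hδ2 : δ ^ 2 = w / 9 := by
    rw [hδ, div_pow, Real.sq_sqrt hw0]
    norm_num
  have hδl : δ ≤ lam / 3 := by
    have : √w ≤ lam := by
      rw [Real.sqrt_le_left hlam.le]
      exact min_le_right _ _
    rw [hδ]
    gcongr
  set a : Fin p := ⟨0, by omega⟩
  set f : Bool → ℝ := fun b => if b then lam else lam - δ with hf
  have hf0 : ∀ b, 0 ≤ f b := fun b => by
    simp only [hf]
    split_ifs <;> linarith
  have hfl : ∀ b, f b ≤ lam := fun b => by
    simp only [hf]
    split_ifs <;> linarith
  have hflow : ∀ b, 2 / 3 * (1 + lam) ≤ 1 + f b := fun b => by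
    simp only [hf]
    split_ifs <;> linarith
  have hfd : ∀ b c, (f b - f c) ^ 2 ≤ δ ^ 2 := fun b c => by
    cases b <;> cases c <;> simp [hf, sq_nonneg]
  have hflow2 : ∀ b c, 4 / 9 * (1 + lam) ^ 2 ≤ (1 + f b) * (1 + f c) := fun b c => by
    calc 4 / 9 * (1 + lam) ^ 2 = (2 / 3 * (1 + lam)) * (2 / 3 * (1 + lam)) := by ring
      _ ≤ (1 + f b) * (1 + f c) :=
        mul_le_mul (hflow b) (hflow c) (by positivity) (by linarith [hf0 b])
  refine le_covMinimaxRisk fun T => ?_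
  obtain ⟨b, hb⟩ := exists_specNorm_risk_ge_of_separated (J := Bool) (n := n) (by simp)
    (fun b => 1 + f b • (unitCol a * (unitCol a)ᵀ)) (fun b c => by
      refine klBound_scaled (unitCol_orthonormal a) (hf0 b) (hf0 c) ?_
      have h1 : (f b - f c) ^ 2 / ((1 + f b) * (1 + f c)) ≤ 1 / (4 * n : ℝ) := by
        have h2 : δ ^ 2 ≤ (1 + lam) ^ 2 / n / 9 := by
          rw [hδ2]
          gcongr
          exact min_le_left _ _
        calc (f b - f c) ^ 2 / ((1 + f b) * (1 + f c))
            ≤ ((1 + lam) ^ 2 / n / 9) / (4 / 9 * (1 + lam) ^ 2) := by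
              exact div_le_div₀ (by positivity) ((hfd b c).trans h2) (by positivity) (hflow2 b c)
          _ = 1 / (4 * n : ℝ) := by field_simp
      have h3 : n * ((f b - f c) ^ 2 / ((1 + f b) * (1 + f c)) / 2) ≤ 1 / 8 := by
        calc n * ((f b - f c) ^ 2 / ((1 + f b) * (1 + f c)) / 2) ≤ n * (1 / (4 * n : ℝ) / 2) := by
              gcongr
          _ = 1 / 8 := by
              field_simp
              norm_num
      have := Real.log_two_gt_d9
      simp only [Fintype.card_bool, Nat.cast_ofNat]
      linarith)
    T.measurable_est (δ := δ ^ 2) (fun b c hbc => by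
      refine le_trans (le_of_eq ?_) (sq_entry_le_specNorm_sq _ a a)
      simp only [Matrix.sub_apply, Matrix.add_apply, Matrix.smul_apply,
        unitCol_mul_transpose_apply, and_self, if_true, smul_eq_mul, mul_one,
        add_sub_add_left_eq_sub]
      cases b <;> cases c <;> simp_all) (sq_nonneg _)
  refine ⟨_, one_add_smul_mem_Theta1 (unitCol_orthonormal a)
    ((ncard_rowSupport_unitCol a).trans (hr.trans hrk)) hr hrk hkp (hf0 b) (hfl b),
    le_trans (le_of_eq ?_) hb⟩
  rw [hδ2]
  congr 1
  ring

/-- Finding the position of a spike along a coordinate axis. -/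
theorem covMinimaxRisk_ge_position {n : ℕ} {lam : ℝ} (hp : 2 ≤ p) (hn : 1 ≤ n) (hlam : 0 < lam) :
    ENNReal.ofReal (1 / 100 * min (Real.log p / n) (lam ^ 2)) ≤ covMinimaxRisk n 1 p 1 lam := by
  have hn0 : (0 : ℝ) < n := by exact_mod_cast hn
  have hlog : 0 ≤ Real.log p := Real.log_natCast_nonneg p
  -- The factor `2/5` makes `n * μ ^ 2 / 2 ≤ log p / 5`; the spike `μ = √w` may be smaller than
  -- `lam`, as `Theta1` allows.
  set w : ℝ := min (2 / 5 * (Real.log p / n)) (lam ^ 2) with hw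
  have hw0 : 0 ≤ w := le_min (by positivity) (by positivity)
  set μ : ℝ := √w with hμ
  have hμ0 : 0 ≤ μ := by positivity
  have hμ2 : μ ^ 2 = w := Real.sq_sqrt hw0
  have hμl : μ ≤ lam := by
    rw [hμ, Real.sqrt_le_left hlam.le]
    exact min_le_right _ _
  refine le_covMinimaxRisk fun T => ?_
  obtain ⟨j, hj⟩ := exists_specNorm_risk_ge_of_separated (J := Fin p) (n := n) (by simpa using hp)
    (fun j => 1 + μ • (unitCol j * (unitCol j)ᵀ)) (fun i j => by
      refine klBound_spiked (unitCol_orthonormal i) (unitCol_orthonormal j) hμ0 ?_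
      have h1 : 0 ≤ ((unitCol j * (unitCol j)ᵀ) * (unitCol i * (unitCol i)ᵀ)).trace := by
        rw [trace_mul_mul_transpose]
        positivity
      have h2 : μ ^ 2 / (1 + μ) ≤ 2 / 5 * (Real.log p / n) :=
        (div_le_self (by positivity) (by linarith)).trans (hμ2.le.trans (min_le_left _ _))
      calc n * (μ ^ 2 / (1 + μ) *
            ((1 : ℕ) - ((unitCol j * (unitCol j)ᵀ) * (unitCol i * (unitCol i)ᵀ)).trace) / 2)
          ≤ n * (μ ^ 2 / (1 + μ) * 1 / 2) := by
            gcongr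
            push_cast
            linarith
        _ ≤ n * (2 / 5 * (Real.log p / n) * 1 / 2) := by gcongr
        _ = Real.log p / 5 := by field_simp
        _ = _ := by rw [Fintype.card_fin])
    T.measurable_est (δ := μ ^ 2) (fun i j hij => by
      refine le_trans (le_of_eq ?_) (sq_entry_le_specNorm_sq _ i i)
      simp [unitCol_mul_transpose_apply, hij]) (sq_nonneg _)
  refine ⟨_, one_add_smul_mem_Theta1 (unitCol_orthonormal j)
    (ncard_rowSupport_unitCol j) le_rfl le_rfl (by omega) hμ0 hμl, le_trans ?_ hj⟩
  refine ENNReal.ofReal_le_ofReal ?_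
  rw [hμ2]
  have : 2 / 5 * min (Real.log p / n) (lam ^ 2) ≤ w := by
    rw [mul_min_of_nonneg _ _ (by norm_num)]
    exact min_le_min le_rfl (by nlinarith [sq_nonneg lam])
  linarith

end TwoPoint

/-! ### Sparse directions built from signed unit vectors -/

section Direction

/-- The vectors `± e_i` of `ℝᵐ`. -/
def signedUnit {m : ℕ} (j : Fin m × Bool) (i : Fin m) : ℝ :=
  if i = j.1 then (if j.2 then 1 else -1) else 0

variable {m : ℕ}

theorem sum_signedUnit_mul_self (j : Fin m × Bool) : ∑ i, signedUnit j i * signedUnit j i = 1 := by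
  rcases j with ⟨j, b⟩
  cases b <;> simp [signedUnit]

theorem sum_signedUnit_mul_nonpos {j j' : Fin m × Bool} (h : j ≠ j') :
    ∑ i, signedUnit j i * signedUnit j' i ≤ 0 := by
  rcases j with ⟨j, b⟩
  rcases j' with ⟨j', b'⟩
  by_cases hj : j = j'
  · subst hj
    cases b <;> cases b' <;> simp_all [signedUnit]
  · simp [signedUnit, Ne.symm hj]

theorem neg_one_le_sum_signedUnit_mul (j j' : Fin m × Bool) :
    -1 ≤ ∑ i, signedUnit j i * signedUnit j' i := by
  have h : 0 ≤ ∑ i, (signedUnit j i + signedUnit j' i) ^ 2 := by positivity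
  have e : ∑ i, (signedUnit j i + signedUnit j' i) ^ 2 = ∑ i, signedUnit j i * signedUnit j i +
      2 * ∑ i, signedUnit j i * signedUnit j' i + ∑ i, signedUnit j' i * signedUnit j' i := by
    rw [Finset.mul_sum, ← Finset.sum_add_distrib, ← Finset.sum_add_distrib]
    exact Finset.sum_congr rfl fun i _ => by ring
  rw [e, sum_signedUnit_mul_self, sum_signedUnit_mul_self] at h
  linarith

theorem two_le_sum_signedUnit_sub_sq {j j' : Fin m × Bool} (h : j ≠ j') :
    2 ≤ ∑ i, (signedUnit j i - signedUnit j' i) ^ 2 := by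
  have e : ∑ i, (signedUnit j i - signedUnit j' i) ^ 2 = ∑ i, signedUnit j i * signedUnit j i -
      2 * ∑ i, signedUnit j i * signedUnit j' i + ∑ i, signedUnit j' i * signedUnit j' i := by
    rw [Finset.mul_sum, ← Finset.sum_sub_distrib, ← Finset.sum_add_distrib]
    exact Finset.sum_congr rfl fun i _ => by ring
  rw [e, sum_signedUnit_mul_self, sum_signedUnit_mul_self]
  linarith [sum_signedUnit_mul_nonpos h]

variable {p r d : ℕ}

/-- An orthonormal frame whose first vector has a signed unit vector, scaled by `s`, in each of
`d` blocks of coordinates, and whose other vectors are fixed. -/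
def sparseFrame (c s : ℝ) (θ : Fin d → Fin m × Bool) :
    Matrix (Fin (r + 1) ⊕ Fin d × Fin m) (Fin (r + 1)) ℝ :=
  Matrix.of fun x l => Sum.elim (fun i => if i = l then (if l = 0 then c else 1) else 0)
    (fun q : Fin d × Fin m => if l = 0 then s * signedUnit (θ q.1) q.2 else 0) x

theorem sparseFrame_transpose_mul (c s : ℝ) (θ θ' : Fin d → Fin m × Bool) :
    (sparseFrame (r := r) c s θ)ᵀ * sparseFrame (r := r) c s θ' = Matrix.diagonal fun l =>
      if l = 0 then c ^ 2 + s ^ 2 * ∑ b, ∑ i, signedUnit (θ b) i * signedUnit (θ' b) i else 1 := by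
  ext l l'
  rw [Matrix.mul_apply, Fintype.sum_sum_type, Fintype.sum_prod_type]
  simp only [sparseFrame, Matrix.transpose_apply, Matrix.of_apply, Sum.elim_inl, Sum.elim_inr]
  by_cases hl : l = l'
  · subst hl
    rw [Matrix.diagonal_apply_eq]
    by_cases h0 : l = 0
    · simp only [h0, if_true, mul_ite, mul_zero, ite_mul, zero_mul, Finset.mul_sum]
      congr 1
      · simp [sq]
      · exact Finset.sum_congr rfl fun b _ => Finset.sum_congr rfl fun i _ => by ring
    · simp [h0]
  · rw [Matrix.diagonal_apply_ne _ hl]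
    have h1 : ∀ i : Fin (r + 1), (if i = l then (if l = 0 then c else 1) else 0) *
        (if i = l' then (if l' = 0 then c else 1) else 0) = 0 := by
      intro i
      by_cases hi : i = l
      · rw [if_neg (fun h => hl (hi.symm.trans h) : ¬ i = l'), mul_zero]
      · rw [if_neg hi, zero_mul]
    have h2 : ∀ x y : ℝ, (if l = 0 then x else 0) * (if l' = 0 then y else 0) = 0 := by
      intro x y
      by_cases h0 : l = 0
      · rw [if_neg (fun h => hl (h0.trans h.symm) : ¬ l' = 0), mul_zero]
      · rw [if_neg h0, zero_mul]
    simp only [h1, h2, Finset.sum_const_zero, add_zero]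

/-- Lower bound for the estimation of a projection onto a sparse subspace. -/
theorem exists_subspace_loss_ge {n : ℕ} (hn : 1 ≤ n) (hd : 1 ≤ d) (hm : 1 ≤ m) {μ : ℝ} (hμ : 0 < μ)
    {e : Fin (r + 1) ⊕ Fin d × Fin m → Fin p} (he : Function.Injective e)
    {T : Data n p → Matrix (Fin p) (Fin p) ℝ} (hT : ∀ i j, Measurable fun x => T x i j) :
    ∃ V : Matrix (Fin p) (Fin (r + 1)) ℝ, Vᵀ * V = 1 ∧ (rowSupport V).ncard ≤ r + 1 + d ∧
      ENNReal.ofReal (1 / 40 * min (d * ((1 + μ) * Real.log (2 * m) / (10 * n * μ ^ 2))) (1 / 2)) ≤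
        ∫⁻ x, ENNReal.ofReal (specNorm (T x - V * Vᵀ) ^ 2) ∂(dataLaw n (1 + μ • (V * Vᵀ))) := by
  have hn0 : (0 : ℝ) < n := by exact_mod_cast hn
  have hd0 : (0 : ℝ) < d := by exact_mod_cast hd
  have hm1 : (1 : ℝ) ≤ m := by exact_mod_cast hm
  have hlog : 0 ≤ Real.log (2 * m) := Real.log_nonneg (by linarith)
  -- `w` is the squared weight of one block. The first bound keeps the divergence of a one-letter
  -- change below `log (2 * m) / 5`; the second leaves at least half of the squared length to the
  -- fixed coordinate.
  set w : ℝ := min ((1 + μ) * Real.log (2 * m) / (10 * n * μ ^ 2)) (1 / (2 * d)) with hw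
  have hw0 : 0 ≤ w := le_min (by positivity) (by positivity)
  have hwd : d * w ≤ 1 / 2 := by
    calc d * w ≤ d * (1 / (2 * d)) := by
          gcongr
          exact min_le_right _ _
      _ = 1 / 2 := by field_simp
  set s := √w
  set c := √(1 - d * w)
  have hs : s ^ 2 = w := Real.sq_sqrt hw0
  have hc : c ^ 2 = 1 - d * w := Real.sq_sqrt (by linarith)
  set V : (Fin d → Fin m × Bool) → Matrix (Fin p) (Fin (r + 1)) ℝ :=
    fun θ => coordEmbed e * sparseFrame (r := r) c s θ with hV
  have hVe : ∀ θ x l, V θ (e x) l = sparseFrame c s θ x l := fun θ x l =>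
    coordEmbed_mul_apply he _ x l
  have hgram : ∀ θ θ', (V θ)ᵀ * V θ' = Matrix.diagonal fun l =>
      if l = 0 then c ^ 2 + s ^ 2 * ∑ b, ∑ i, signedUnit (θ b) i * signedUnit (θ' b) i else 1 := by
    intro θ θ'
    rw [← sparseFrame_transpose_mul, hV, Matrix.transpose_mul, Matrix.mul_assoc,
      ← Matrix.mul_assoc _ᵀ (coordEmbed e), coordEmbed_transpose_mul_self he, Matrix.one_mul]
  have horth : ∀ θ, (V θ)ᵀ * V θ = 1 := by
    intro θ
    rw [hgram, ← Matrix.diagonal_one]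
    congr 1
    ext l
    simp only [sum_signedUnit_mul_self, Finset.sum_const, Finset.card_univ, Fintype.card_fin,
      nsmul_eq_mul, mul_one, hc, hs]
    split_ifs
    · ring
    · rfl
  -- Changing one letter lowers one block product from `1` to at worst `-1`. The first Gram entry
  -- `g` is then at least `1 - 2 * w`, and `1 - g ^ 2 ≤ 2 * (1 - g) ≤ 4 * w`.
  have hupd : ∀ (θ : Fin d → Fin m × Bool) b j,
      (r + 1 : ℕ) - ((V (Function.update θ b j) * (V (Function.update θ b j))ᵀ) *
        (V θ * (V θ)ᵀ)).trace ≤ 4 * w := by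
    intro θ b j
    rw [trace_mul_mul_transpose, hgram]
    set g : ℝ := c ^ 2 + s ^ 2 *
      ∑ b', ∑ i, signedUnit (Function.update θ b j b') i * signedUnit (θ b') i with hg
    have hg1 : 1 - 2 * w ≤ g := by
      have : (d : ℝ) - 2 ≤
          ∑ b', ∑ i, signedUnit (Function.update θ b j b') i * signedUnit (θ b') i := by
        have h1 : ∀ b', (1 : ℝ) - (if b' = b then 2 else 0) ≤
            ∑ i, signedUnit (Function.update θ b j b') i * signedUnit (θ b') i := by
          intro b'
          by_cases hb : b' = b
          · rw [if_pos hb]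
            linarith [neg_one_le_sum_signedUnit_mul (Function.update θ b j b') (θ b')]
          · rw [if_neg hb, Function.update_of_ne hb, sum_signedUnit_mul_self, sub_zero]
        refine le_trans (le_of_eq ?_) (Finset.sum_le_sum fun b' _ => h1 b')
        simp
      rw [hg, hc, hs]
      nlinarith
    have hsum : ∑ i : Fin (r + 1), ∑ j : Fin (r + 1), (Matrix.diagonal
        (fun l : Fin (r + 1) => if l = 0 then g else 1) i j) ^ 2 = g ^ 2 + r := by
      have : ∀ i j : Fin (r + 1), (Matrix.diagonal
          (fun l : Fin (r + 1) => if l = 0 then g else 1) i j) ^ 2 =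
          if i = j then (if i = 0 then g ^ 2 else 1) else 0 := by
        intro i j
        rw [Matrix.diagonal_apply]
        split_ifs <;> simp
      simp only [this, Finset.sum_ite_eq, Finset.mem_univ, if_true]
      rw [Fin.sum_univ_succ]
      simp
    rw [hsum]
    push_cast
    nlinarith [sq_nonneg (1 - g)]
  have hcard : Fintype.card (Fin m × Bool) = 2 * m := by
    rw [Fintype.card_prod, Fintype.card_fin, Fintype.card_bool, mul_comm]
  have hcard' : ((Fintype.card (Fin m × Bool) : ℕ) : ℝ) = 2 * m := by
    rw [hcard]
    push_cast
    ring
  obtain ⟨θ, hθ⟩ := exists_specNorm_risk_ge_of_blocks (n := n) (B := Fin d) (J := Fin m × Bool)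
    (I := Fin m) (by omega) (fun θ => 1 + μ • (V θ * (V θ)ᵀ)) (fun θ => V θ * (V θ)ᵀ)
    (fun θ b j => by
      refine klBound_spiked (horth _) (horth _) hμ.le ?_
      rw [hcard']
      calc n * (μ ^ 2 / (1 + μ) * ((r + 1 : ℕ) - ((V (Function.update θ b j) *
            (V (Function.update θ b j))ᵀ) * (V θ * (V θ)ᵀ)).trace) / 2)
          ≤ n * (μ ^ 2 / (1 + μ) * (4 * w) / 2) := by
            gcongr
            exact hupd θ b j
        _ ≤ n * (μ ^ 2 / (1 + μ) * (4 * ((1 + μ) * Real.log (2 * m) / (10 * n * μ ^ 2))) / 2) := by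
            gcongr
            exact min_le_left _ _
        _ = Real.log (2 * m) / 5 := by
            field_simp
            ring)
    hT (e := fun q => e (Sum.inr q)) (he.comp Sum.inr_injective) (e (Sum.inl 0))
    (fun j i => s * c * signedUnit j i) (fun θ b i => by
      rw [Matrix.mul_apply, Finset.sum_eq_single 0]
      · rw [Matrix.transpose_apply, hVe, hVe]
        simp only [sparseFrame, Matrix.of_apply, Sum.elim_inl, Sum.elim_inr, if_true]
        ring
      · intro l _ hl
        rw [hVe]
        simp [sparseFrame, hl]
      · simp) (δ := w) hw0 (fun i j hij => by
      -- The separation is at least `2 * w * (1 - d * w) ≥ w`, since `d * w ≤ 1 / 2`.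
      have h2 := two_le_sum_signedUnit_sub_sq hij
      have : ∑ q, (s * c * signedUnit i q - s * c * signedUnit j q) ^ 2 =
          w * (1 - d * w) * ∑ q, (signedUnit i q - signedUnit j q) ^ 2 := by
        rw [← hc, ← hs, Finset.mul_sum]
        exact Finset.sum_congr rfl fun q _ => by ring
      rw [this]
      nlinarith [mul_nonneg hw0 (by linarith : 0 ≤ 1 / 2 - d * w),
        mul_nonneg (mul_nonneg hw0 (by linarith : 0 ≤ 1 - d * w)) (sub_nonneg.mpr h2)])
  refine ⟨V θ, horth θ, ?_, le_trans (le_of_eq ?_) hθ⟩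
  · refine (ncard_rowSupport_coordEmbed_mul_le he _).trans ?_
    set φ : Fin (r + 1) ⊕ Fin d → Fin (r + 1) ⊕ Fin d × Fin m :=
      Sum.map id fun b => (b, (θ b).1)
    have hsub : {x | ∃ l, sparseFrame (r := r) c s θ x l ≠ 0} ⊆ Set.range φ := by
      rintro (i | ⟨b, i⟩) ⟨l, hl⟩
      · exact ⟨Sum.inl i, rfl⟩
      · refine ⟨Sum.inr b, ?_⟩
        by_contra h
        refine hl ?_
        have : i ≠ (θ b).1 := fun hi => h (by simp [φ, hi])
        simp [sparseFrame, signedUnit, this]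
    refine (Set.ncard_le_ncard hsub (Set.toFinite _)).trans ?_
    rw [← Set.image_univ]
    refine (Set.ncard_image_le (Set.toFinite _)).trans ?_
    simp [Set.ncard_univ]
  · rw [Fintype.card_fin, hw, show (d : ℝ) * min ((1 + μ) * Real.log (2 * m) / (10 * n * μ ^ 2))
      (1 / (2 * (d : ℝ))) / 40 = 1 / 40 * (d * min ((1 + μ) * Real.log (2 * m) / (10 * n * μ ^ 2))
      (1 / (2 * (d : ℝ)))) by ring, mul_min_of_nonneg _ _ hd0.le]
    congr 3
    field_simp

end Direction

/-! ### Full-rank blocks built from shears -/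

section Shear

variable {d : ℕ}

/-- The vector with first entry zero and the other entries given by signs. -/
def signVec (θ : Fin d → Bool) : Fin (d + 1) → ℝ := Fin.cons 0 fun b => if θ b then 1 else -1

theorem signVec_zero (θ : Fin d → Bool) : signVec θ 0 = 0 := rfl

theorem signVec_succ (θ : Fin d → Bool) (b : Fin d) :
    signVec θ b.succ = if θ b then 1 else -1 := rfl

theorem signVec_dotProduct_self (θ : Fin d → Bool) : signVec θ ⬝ᵥ signVec θ = d := by
  rw [dotProduct, Fin.sum_univ_succ, signVec_zero, mul_zero, zero_add]
  have : ∀ b : Fin d, signVec θ b.succ * signVec θ b.succ = 1 := fun b => by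
    rw [signVec_succ]
    split_ifs <;> norm_num
  simp [this]

theorem signVec_sub_update (θ : Fin d → Bool) (b : Fin d) (j : Bool) :
    (signVec θ - signVec (Function.update θ b j)) ⬝ᵥ
      (signVec θ - signVec (Function.update θ b j)) ≤ 4 := by
  rw [dotProduct, Fin.sum_univ_succ, Pi.sub_apply, signVec_zero, signVec_zero, sub_zero, mul_zero,
    zero_add]
  have : ∀ b' : Fin d, (signVec θ - signVec (Function.update θ b j)) b'.succ *
      (signVec θ - signVec (Function.update θ b j)) b'.succ ≤ if b' = b then 4 else 0 := by
    intro b'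
    rw [Pi.sub_apply, signVec_succ, signVec_succ]
    by_cases hb : b' = b
    · rw [if_pos hb]
      split_ifs <;> norm_num
    · rw [if_neg hb, Function.update_of_ne hb, sub_self, mul_zero]
  refine (Finset.sum_le_sum fun b' _ => this b').trans (le_of_eq ?_)
  simp

/-- The matrix with first column `w` and zeros elsewhere. -/
def firstCol (w : Fin (d + 1) → ℝ) : Matrix (Fin (d + 1)) (Fin (d + 1)) ℝ :=
  Matrix.vecMulVec w (Pi.single 0 1)

theorem firstCol_mul_firstCol (w w' : Fin (d + 1) → ℝ) (hw' : w' 0 = 0) :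
    firstCol w * firstCol w' = 0 := by
  rw [firstCol, firstCol, Matrix.vecMulVec_mul_vecMulVec, single_one_dotProduct, hw', zero_smul]
  simp

theorem trace_firstCol (w : Fin (d + 1) → ℝ) : (firstCol w).trace = w 0 := by
  rw [firstCol, Matrix.trace_vecMulVec, dotProduct_single_one]

theorem trace_firstCol_mul_transpose (w : Fin (d + 1) → ℝ) :
    (firstCol w * (firstCol w)ᵀ).trace = w ⬝ᵥ w := by
  rw [firstCol, Matrix.transpose_vecMulVec, Matrix.vecMulVec_mul_vecMulVec,
    single_one_dotProduct, Pi.single_eq_same, one_smul, Matrix.trace_vecMulVec]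

/-- A scaled shear in the direction of the first coordinate. -/
def shear (σ s : ℝ) (w : Fin (d + 1) → ℝ) : Matrix (Fin (d + 1)) (Fin (d + 1)) ℝ :=
  σ • (1 + s • firstCol w)

/-- Products of `firstCol` matrices vanish when the right factor's vector starts with zero, so
shears compose additively. The scale `σ` cancels, which makes the divergence independent of it. -/
theorem shear_inv_mul_shear {σ : ℝ} (hσ : σ ≠ 0) (s : ℝ) {w w' : Fin (d + 1) → ℝ} (hw : w 0 = 0) :
    shear σ⁻¹ (-s) w' * shear σ s w = 1 + s • firstCol (w - w') := by
  have hsub : firstCol (w - w') = firstCol w - firstCol w' := Matrix.sub_vecMulVec _ _ _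
  rw [shear, shear, Matrix.smul_mul, Matrix.mul_smul, smul_smul, inv_mul_cancel₀ hσ, one_smul]
  simp only [Matrix.add_mul, Matrix.mul_add, Matrix.one_mul, Matrix.mul_one, Matrix.smul_mul,
    Matrix.mul_smul, firstCol_mul_firstCol _ _ hw, smul_zero, add_zero, hsub, smul_sub, neg_smul,
    Matrix.neg_mul, neg_zero]
  abel

theorem det_shear (σ s : ℝ) {w : Fin (d + 1) → ℝ} (hw : w 0 = 0) :
    (shear σ s w).det = σ ^ (d + 1) := by
  rw [shear, Matrix.det_smul, Fintype.card_fin, firstCol, ← Matrix.smul_vecMulVec,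
    Matrix.vecMulVec_eq Unit, Matrix.det_one_add_replicateCol_mul_replicateRow,
    single_one_dotProduct, Pi.smul_apply, hw, smul_zero, add_zero, mul_one]

theorem shear_mul_transpose_quadForm (σ s : ℝ) (w x : Fin (d + 1) → ℝ) :
    x ⬝ᵥ (shear σ s w * (shear σ s w)ᵀ) *ᵥ x =
      σ ^ 2 * (x ⬝ᵥ x + 2 * (s * (x ⬝ᵥ w)) * x 0 + (s * (x ⬝ᵥ w)) ^ 2) := by
  have h : (shear σ s w)ᵀ *ᵥ x = σ • (x + (s * (x ⬝ᵥ w)) • Pi.single 0 1) := by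
    rw [Matrix.mulVec_transpose, shear, Matrix.vecMul_smul, Matrix.vecMul_add, Matrix.vecMul_one,
      Matrix.vecMul_smul, firstCol, Matrix.vecMul_vecMulVec, smul_smul]
  rw [← Matrix.mulVec_mulVec, Matrix.dotProduct_mulVec, ← Matrix.mulVec_transpose, h]
  simp only [smul_dotProduct, dotProduct_smul, add_dotProduct, dotProduct_add,
    dotProduct_single_one, single_one_dotProduct, smul_eq_mul, Pi.smul_apply, Pi.add_apply,
    Pi.single_eq_same]
  ring

theorem shear_mul_transpose_apply (σ s : ℝ) {w : Fin (d + 1) → ℝ} (hw : w 0 = 0) (b : Fin d) :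
    (shear σ s w * (shear σ s w)ᵀ) b.succ 0 = σ ^ 2 * s * w b.succ := by
  have h0 : ∀ l, shear σ s w 0 l = if l = 0 then σ else 0 := by
    intro l
    simp [shear, firstCol, Matrix.vecMulVec_apply, hw, Matrix.one_apply, eq_comm]
  rw [Matrix.mul_apply]
  simp only [Matrix.transpose_apply, h0, mul_ite, mul_zero, Finset.sum_ite_eq', Finset.mem_univ,
    if_true]
  simp [shear, firstCol, Matrix.vecMulVec_apply]
  ring

/-- Estimating a full covariance matrix of dimension at least two. -/
theorem covMinimaxRisk_ge_shear {n k p r : ℕ} {lam : ℝ} (hr : 2 ≤ r) (hrk : r ≤ k) (hkp : k ≤ p)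
    (hn : 1 ≤ n) (hlam : 1 ≤ lam) :
    ENNReal.ofReal (1 / 32000 * min (lam ^ 2 * r / n) (lam ^ 2)) ≤ covMinimaxRisk n k p r lam := by
  obtain ⟨d, rfl⟩ : ∃ d, r = d + 1 := ⟨r - 1, by omega⟩
  have hn0 : (0 : ℝ) < n := by exact_mod_cast hn
  have hd1 : (1 : ℝ) ≤ d := by exact_mod_cast (by omega : 1 ≤ d)
  set e : Fin (d + 1) → Fin p := Fin.castLE (hrk.trans hkp)
  have he : Function.Injective e := Fin.castLE_injective _
  -- The first bound keeps the divergence `2 * n * ω` of a sign flip below `log 2 / 5`. The second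
  -- confines the form of `H θ` to between `0.8` and `1.21` times `σ ^ 2`, which for `σ ^ 2 = 1 +
  -- lam / 2` and `lam ≥ 1` lies in `[1, 1 + lam]`.
  set ω : ℝ := min (1 / (16 * n)) (1 / (100 * d)) with hω
  have hω0 : 0 ≤ ω := le_min (by positivity) (by positivity)
  have hωd : ω * d ≤ 1 / 100 := by
    calc ω * d ≤ 1 / (100 * d) * d := by
          gcongr
          exact min_le_right _ _
      _ = 1 / 100 := by field_simp
  set s := √ω
  have hs : s ^ 2 = ω := Real.sq_sqrt hω0
  set σ := √(1 + lam / 2)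
  have hσ2 : σ ^ 2 = 1 + lam / 2 := Real.sq_sqrt (by positivity)
  have hσ : σ ≠ 0 := fun h => by
    rw [h] at hσ2
    linarith
  set H : (Fin d → Bool) → Matrix (Fin (d + 1)) (Fin (d + 1)) ℝ :=
    fun θ => shear σ s (signVec θ) * (shear σ s (signVec θ))ᵀ with hH
  have hform : ∀ θ x, x ⬝ᵥ x ≤ x ⬝ᵥ H θ *ᵥ x ∧ x ⬝ᵥ H θ *ᵥ x ≤ (1 + lam) * (x ⬝ᵥ x) := by
    intro θ x
    have e1 := shear_mul_transpose_quadForm σ s (signVec θ) x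
    have hcs : (x ⬝ᵥ signVec θ) ^ 2 ≤ (x ⬝ᵥ x) * d := by
      rw [← signVec_dotProduct_self θ]
      simpa [dotProduct, sq] using Finset.sum_mul_sq_le_sq_mul_sq Finset.univ x (signVec θ)
    have hx0 : x 0 ^ 2 ≤ x ⬝ᵥ x := by
      rw [sq]
      exact Finset.single_le_sum (f := fun i => x i * x i) (fun i _ => mul_self_nonneg _)
        (Finset.mem_univ 0)
    have hxx : 0 ≤ x ⬝ᵥ x := le_trans (sq_nonneg _) hx0
    set t := s * (x ⬝ᵥ signVec θ)
    have ht : t ^ 2 ≤ (x ⬝ᵥ x) / 100 := by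
      rw [mul_pow, hs]
      nlinarith
    have hq1 : 8 / 10 * (x ⬝ᵥ x) ≤ x ⬝ᵥ x + 2 * t * x 0 + t ^ 2 := by
      nlinarith [sq_nonneg (10 * t + x 0)]
    have hq2 : x ⬝ᵥ x + 2 * t * x 0 + t ^ 2 ≤ 121 / 100 * (x ⬝ᵥ x) := by
      nlinarith [sq_nonneg (10 * t - x 0)]
    rw [e1, hσ2]
    constructor <;> nlinarith
  have hherm : ∀ θ, (H θ - 1).IsHermitian := by
    intro θ
    refine Matrix.IsHermitian.sub ?_ Matrix.isHermitian_one
    have := Matrix.isHermitian_mul_conjTranspose_self (shear σ s (signVec θ))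
    rwa [Matrix.conjTranspose_eq_transpose_of_trivial] at this
  have hps : ∀ θ, (H θ - 1).PosSemidef := by
    intro θ
    refine Matrix.PosSemidef.of_dotProduct_mulVec_nonneg (hherm θ) fun x => ?_
    rw [star_trivial, Matrix.sub_mulVec, Matrix.one_mulVec, dotProduct_sub, sub_nonneg]
    exact (hform θ x).1
  set R : (Fin d → Bool) → Matrix (Fin (d + 1)) (Fin (d + 1)) ℝ :=
    fun θ => (shear σ⁻¹ (-s) (signVec θ))ᵀ * shear σ⁻¹ (-s) (signVec θ) with hR
  have hinv : ∀ θ : Fin d → Bool, shear σ⁻¹ (-s) (signVec θ) * shear σ s (signVec θ) = 1 := by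
    intro θ
    rw [shear_inv_mul_shear hσ s (signVec_zero θ), sub_self, firstCol, Matrix.zero_vecMulVec,
      smul_zero, add_zero]
  have hRH : ∀ θ, R θ * H θ = 1 := by
    intro θ
    simp only [hR, hH]
    rw [Matrix.mul_assoc, ← Matrix.mul_assoc (shear σ⁻¹ (-s) (signVec θ)), hinv, Matrix.one_mul,
      ← Matrix.transpose_mul, mul_eq_one_comm.mp (hinv θ), Matrix.transpose_one]
  have htr : ∀ θ b j, (R (Function.update θ b j) * H θ).trace ≤ d + 1 + 4 * ω := by
    intro θ b j
    simp only [hR, hH]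
    -- Rotating the trace turns it into the squared Frobenius norm of `1 + s • firstCol u`; the
    -- cross term is `u 0 = 0`.
    rw [Matrix.mul_assoc, Matrix.trace_mul_comm, ← Matrix.mul_assoc, Matrix.mul_assoc,
      ← Matrix.transpose_mul, shear_inv_mul_shear hσ s (signVec_zero θ)]
    set u := signVec θ - signVec (Function.update θ b j)
    have hu : u 0 = 0 := by simp [u, signVec_zero]
    rw [Matrix.transpose_add, Matrix.transpose_one, Matrix.transpose_smul, Matrix.mul_add,
      Matrix.mul_one, Matrix.add_mul, Matrix.one_mul, Matrix.smul_mul, Matrix.mul_smul]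
    simp only [Matrix.trace_add, Matrix.trace_smul, Matrix.trace_transpose, trace_firstCol, hu,
      trace_firstCol_mul_transpose, Matrix.trace_one, Fintype.card_fin, smul_eq_mul, mul_zero,
      add_zero, zero_add, Nat.cast_add, Nat.cast_one]
    have := signVec_sub_update θ b j
    nlinarith
  have hHe : ∀ θ b, H θ (Fin.succ b) 0 = σ ^ 2 * s * if θ b then 1 else -1 := fun θ b =>
    shear_mul_transpose_apply σ s (signVec_zero θ) b
  have hdet : ∀ θ, (H θ).det = σ ^ (d + 1) * σ ^ (d + 1) := by
    intro θ
    simp only [hH]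
    rw [Matrix.det_mul, Matrix.det_transpose, det_shear σ s (signVec_zero θ)]
  refine le_covMinimaxRisk fun T => ?_
  obtain ⟨θ, hθ⟩ := exists_specNorm_risk_ge_of_blocks (n := n) (B := Fin d) (J := Bool)
    (I := Unit) (by simp) (fun θ => extendOne e (H θ)) (fun θ => extendOne e (H θ))
    (fun θ b j => by
      refine klBound_dataLaw (posDef_extendOne (hps _)) (posDef_extendOne (hps _))
        (R := extendOne e (R (Function.update θ b j)))
        (by rw [extendOne_mul he, hRH, extendOne_one]) n ?_
      rw [extendOne_mul he, trace_extendOne he, det_extendOne he, det_extendOne he, hdet, hdet,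
        Fintype.card_fin]
      have h1 : ω ≤ 1 / (16 * n) := min_le_left _ _
      have h2 : n * ω ≤ 1 / 16 := by
        calc n * ω ≤ n * (1 / (16 * n)) := by gcongr
          _ = 1 / 16 := by field_simp
      have := Real.log_two_gt_d9
      have h3 := htr θ b j
      simp only [Fintype.card_bool, Nat.cast_ofNat]
      push_cast
      nlinarith)
    T.measurable_est (e := fun q => e q.1.succ) (fun q q' h => by
      ext1
      · exact Fin.succ_injective _ (he h)
      · rfl) (e 0) (fun j _ => σ ^ 2 * s * if j then 1 else -1) (fun θ b i => by
      rw [extendOne_apply_of_ne he _ (Fin.succ_ne_zero b), hHe])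
    (δ := 4 * (σ ^ 2) ^ 2 * ω) (by positivity) (fun i j hij => by
      rw [← hs]
      refine le_of_eq ?_
      cases i <;> cases j <;> first
        | exact absurd rfl hij
        | simp only [Finset.univ_unique, Finset.sum_singleton, if_true, if_false,
            Bool.false_eq_true]
          ring)
  refine ⟨_, extendOne_mem_Theta1 he hrk (hherm θ) (fun x => (hform θ x).1)
    (fun x => (hform θ x).2), le_trans (ENNReal.ofReal_le_ofReal ?_) hθ⟩
  rw [Fintype.card_fin, hσ2]
  have h1 : 1 / 200 * min ((d + 1 : ℝ) / n) 1 ≤ d * ω := by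
    rw [hω, mul_min_of_nonneg _ _ (by positivity), mul_min_of_nonneg _ _ (by positivity)]
    refine min_le_min ?_ ?_
    · rw [mul_one_div, ← mul_div_assoc, div_le_div_iff₀ hn0 (by positivity)]
      nlinarith
    · rw [mul_one_div, mul_one, le_div_iff₀ (by positivity)]
      linarith
  have h2 : min (lam ^ 2 * (d + 1 : ℕ) / n) (lam ^ 2) = lam ^ 2 * min ((d + 1 : ℝ) / n) 1 := by
    rw [mul_min_of_nonneg _ _ (by positivity)]
    push_cast
    congr 1 <;> ring
  rw [h2]
  have h3 : lam ^ 2 / 4 ≤ (1 + lam / 2) ^ 2 := by nlinarith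
  have h4 : 0 ≤ d * ω := by positivity
  calc 1 / 32000 * (lam ^ 2 * min ((d + 1 : ℝ) / n) 1)
      = lam ^ 2 / 160 * (1 / 200 * min ((d + 1 : ℝ) / n) 1) := by ring
    _ ≤ lam ^ 2 / 160 * (d * ω) := by gcongr
    _ ≤ (lam ^ 2 / 4) * (d * ω) / 10 := by nlinarith [mul_nonneg (sq_nonneg lam) h4]
    _ ≤ (1 + lam / 2) ^ 2 * (d * ω) / 10 := by gcongr
    _ = _ := by ring

end Shear

/-! ### Assembling the minimax bounds -/

section Minimax

/-- `q / d ≤ 2 * ⌊q / d⌋` handles the logarithm, and the extra `1` from `e` is at most `3/2 * log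
2`. The factor `2` from the signs is essential: it keeps the right side positive when `⌊q / d⌋ = 1`.
-/
theorem log_exp_one_mul_div_le {q d : ℕ} (hd : 1 ≤ d) (hdq : d ≤ q) :
    Real.log (Real.exp 1 * (q : ℝ) / d) ≤ 5 / 2 * Real.log (2 * (q / d : ℕ)) := by
  have hd0 : (0 : ℝ) < d := by exact_mod_cast hd
  have hq0 : (0 : ℝ) < q := by exact_mod_cast hd.trans hdq
  have hm : 1 ≤ q / d := (Nat.one_le_div_iff (by omega)).mpr hdq
  have hm1 : (1 : ℝ) ≤ (q / d : ℕ) := by exact_mod_cast hm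
  have hlt : (q : ℝ) / d ≤ 2 * (q / d : ℕ) := by
    rw [div_le_iff₀ hd0]
    have h1 : q < d * (q / d + 1) := Nat.lt_mul_div_succ q (by omega)
    have h2 : (q : ℝ) ≤ d * ((q / d : ℕ) + 1) := by exact_mod_cast h1.le
    nlinarith
  have h1 : Real.log (q / d) ≤ Real.log (2 * (q / d : ℕ)) :=
    Real.log_le_log (by positivity) hlt
  have h2 : Real.log 2 ≤ Real.log (2 * (q / d : ℕ)) :=
    Real.log_le_log (by norm_num) (by linarith)
  rw [mul_div_assoc, Real.log_mul (Real.exp_ne_zero 1) (by positivity), Real.log_exp]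
  linarith [Real.log_two_gt_d9]

theorem exists_injective_blocks {p r d : ℕ} (hrd : r + d ≤ p) :
    ∃ e : Fin r ⊕ Fin d × Fin ((p - r) / d) → Fin p, Function.Injective e := by
  obtain ⟨e⟩ : Nonempty (Fin r ⊕ Fin d × Fin ((p - r) / d) ↪ Fin p) := by
    refine Function.Embedding.nonempty_of_card_le ?_
    simp only [Fintype.card_sum, Fintype.card_prod, Fintype.card_fin]
    have := Nat.mul_div_le (p - r) d
    omega
  exact ⟨e, e.injective⟩

variable {n k p r : ℕ} {lam : ℝ}

/-- Estimating the direction of a sparse spike. -/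
theorem covMinimaxRisk_ge_direction (hk : 2 ≤ k) (hr : 1 ≤ r) (hrk : r ≤ k) (hkp : k ≤ p)
    (hn : 1 ≤ n) (hlam : 0 < lam) :
    ENNReal.ofReal (1 / 2000 * min
      ((lam + 1) * (k : ℝ) / (n : ℝ) * Real.log (Real.exp 1 * (p : ℝ) / (k : ℝ))) (lam ^ 2)) ≤
    covMinimaxRisk n k p r lam := by
  obtain ⟨d, rfl⟩ : ∃ d, k = d + 1 := ⟨k - 1, by omega⟩
  have hd : 1 ≤ d := by omega
  have hdp : d ≤ p - 1 := by omega
  have hn0 : (0 : ℝ) < n := by exact_mod_cast hn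
  have hd1 : (1 : ℝ) ≤ d := by exact_mod_cast hd
  have hdp' : (d + 1 : ℝ) ≤ p := by exact_mod_cast hkp
  have hp0 : (0 : ℝ) < p := by linarith
  refine le_covMinimaxRisk fun T => ?_
  obtain ⟨e, he⟩ := exists_injective_blocks (p := p) (r := 0 + 1) (d := d) (by omega)
  -- A covariance estimate `T` yields the estimate `(T - 1) / lam` of `V * Vᵀ`, with squared loss
  -- scaled by `lam ^ 2`. One row goes to the fixed coordinate, hence `d = k - 1`.
  obtain ⟨V, hV, hsupp, hle⟩ := exists_subspace_loss_ge hn hd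
    ((Nat.one_le_div_iff (by omega)).mpr hdp) hlam he
    (T := fun x => lam⁻¹ • (T.est x - 1)) (fun i j => by
      simp only [Matrix.smul_apply, Matrix.sub_apply, smul_eq_mul]
      exact ((T.measurable_est i j).sub_const _).const_mul _)
  refine ⟨_, one_add_smul_mem_Theta1 hV (hsupp.trans (by omega)) hr hrk hkp hlam.le le_rfl, ?_⟩
  have hscale : ∀ x, ENNReal.ofReal (specNorm (T.est x - (1 + lam • (V * Vᵀ))) ^ 2) =
      ENNReal.ofReal (lam ^ 2) *
        ENNReal.ofReal (specNorm (lam⁻¹ • (T.est x - 1) - V * Vᵀ) ^ 2) := by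
    intro x
    rw [← ENNReal.ofReal_mul (sq_nonneg _), ← mul_pow]
    congr 2
    rw [← abs_of_pos hlam, ← specNorm_smul, abs_of_pos hlam, smul_sub, smul_smul,
      mul_inv_cancel₀ hlam.ne', one_smul, sub_sub]
  simp only [hscale]
  rw [lintegral_const_mul' _ _ ENNReal.ofReal_ne_top]
  refine le_trans ?_ (mul_le_mul_right hle _)
  rw [← ENNReal.ofReal_mul (sq_nonneg _)]
  refine ENNReal.ofReal_le_ofReal ?_
  set L := Real.log (2 * ((p - (0 + 1)) / d : ℕ))
  have hL : Real.log (Real.exp 1 * (p : ℝ) / ((d + 1 : ℕ) : ℝ)) ≤ 5 / 2 * L := by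
    refine le_trans (Real.log_le_log (by positivity) ?_) (log_exp_one_mul_div_le hd hdp)
    rw [mul_div_assoc, mul_div_assoc]
    refine mul_le_mul_of_nonneg_left ?_ (Real.exp_pos 1).le
    rw [Nat.cast_sub (by omega), div_le_div_iff₀ (by positivity) (by positivity)]
    push_cast
    nlinarith
  have hL0 : 0 ≤ L := by
    refine Real.log_nonneg ?_
    have : (1 : ℝ) ≤ ((p - (0 + 1)) / d : ℕ) := by
      exact_mod_cast (Nat.one_le_div_iff (by omega)).mpr hdp
    linarith
  have e1 : lam ^ 2 * (1 / 40 * min (d * ((1 + lam) * L / (10 * n * lam ^ 2))) (1 / 2)) =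
      1 / 2000 * min (5 * d * (1 + lam) * L / n) (25 * lam ^ 2) := by
    rw [← mul_assoc, mul_comm (lam ^ 2), mul_assoc, mul_min_of_nonneg _ _ (sq_nonneg lam),
      show (1 : ℝ) / 40 = 1 / 2000 * 50 by norm_num, mul_assoc,
      mul_min_of_nonneg _ _ (by norm_num : (0 : ℝ) ≤ 50)]
    congr 2
    · field_simp
      ring
    · ring
  rw [e1]
  refine mul_le_mul_of_nonneg_left (min_le_min ?_ ?_) (by norm_num)
  · calc (lam + 1) * ((d + 1 : ℕ) : ℝ) / n * Real.log (Real.exp 1 * (p : ℝ) / ((d + 1 : ℕ) : ℝ))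
        ≤ (lam + 1) * ((d + 1 : ℕ) : ℝ) / n * (5 / 2 * L) := by gcongr
      _ ≤ (lam + 1) * (2 * d) / n * (5 / 2 * L) := by
        gcongr
        push_cast
        linarith
      _ = 5 * d * (1 + lam) * L / n := by ring
  · nlinarith [sq_nonneg lam]

theorem subspaceMinimaxRisk_ge {τ : ℝ} (hr : 1 ≤ r) (hrk : r ≤ k) (hkp : k ≤ p) (hn : 1 ≤ n)
    (hlam : 0 < lam) (hτ : 1 ≤ τ) :
    ENNReal.ofReal (1 / 1000 * min
      ((lam + 1) * ((k : ℝ) - (r : ℝ)) / ((n : ℝ) * lam ^ 2)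
        * Real.log (Real.exp 1 * ((p : ℝ) - (r : ℝ)) / ((k : ℝ) - (r : ℝ)))) 1) ≤
    subspaceMinimaxRisk n k p r lam τ := by
  rcases hrk.eq_or_lt with rfl | hlt
  -- For `k = r` the factor `k - r` vanishes and the bound is zero.
  · simp
  obtain ⟨d, rfl⟩ : ∃ d, k = r + d := ⟨k - r, by omega⟩
  obtain ⟨r, rfl⟩ : ∃ r', r = r' + 1 := ⟨r - 1, by omega⟩
  have hd : 1 ≤ d := by omega
  have hdp : d ≤ p - (r + 1) := by omega
  have hn0 : (0 : ℝ) < n := by exact_mod_cast hn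
  have hd1 : (1 : ℝ) ≤ d := by exact_mod_cast hd
  refine le_iInf fun T => ?_
  obtain ⟨e, he⟩ := exists_injective_blocks (p := p) (r := r + 1) (d := d) (by omega)
  obtain ⟨V, hV, hsupp, hle⟩ := exists_subspace_loss_ge hn hd
    ((Nat.one_le_div_iff (by omega)).mpr hdp) hlam he T.measurable_proj
  -- All spikes equal `lam`, so the family lies in `Theta0` for every `τ ≥ 1`.
  have hsp : IsSpiked (r + 1 + d) (lam / τ) lam V (fun _ => lam) (1 + lam • (V * Vᵀ)) :=
    ⟨hV, hsupp, antitone_const, fun _ => div_le_self hlam.le hτ, fun _ => le_rfl, by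
      rw [add_comm, ← Matrix.smul_one_eq_diagonal, Matrix.mul_smul, Matrix.mul_one,
        Matrix.smul_mul]⟩
  refine le_trans (le_trans ?_ hle) (le_iSup₂_of_le (1 + lam • (V * Vᵀ)) ⟨V, _, hsp⟩
    (le_iSup₂_of_le V _ (le_iSup_of_le hsp le_rfl)))
  refine ENNReal.ofReal_le_ofReal ?_
  set L := Real.log (2 * ((p - (r + 1)) / d : ℕ))
  have hL : Real.log (Real.exp 1 * ((p - (r + 1) : ℕ) : ℝ) / d) ≤ 5 / 2 * L :=
    log_exp_one_mul_div_le hd hdp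
  have e1 : ((r + 1 + d : ℕ) : ℝ) - ((r + 1 : ℕ) : ℝ) = d := by
    push_cast
    ring
  have e2 : (1 : ℝ) / 40 * min (d * ((1 + lam) * L / (10 * n * lam ^ 2))) (1 / 2) =
      1 / 1000 * min ((1 + lam) * d / (n * lam ^ 2) * (5 / 2 * L)) (25 / 2) := by
    rw [show (1 : ℝ) / 40 = 1 / 1000 * 25 by norm_num, mul_assoc,
      mul_min_of_nonneg _ _ (by norm_num : (0 : ℝ) ≤ 25)]
    congr 2
    · field_simp
      ring
    · norm_num
  rw [e2, e1, ← Nat.cast_sub (by omega : r + 1 ≤ p)]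
  refine mul_le_mul_of_nonneg_left (min_le_min ?_ (by norm_num)) (by norm_num)
  rw [add_comm lam]
  gcongr

theorem min_add_le_min_add_min {a b c : ℝ} (ha : 0 ≤ a) (hb : 0 ≤ b) (hc : 0 ≤ c) :
    min (a + b) c ≤ min a c + min b c := by
  rcases le_total a c with h1 | h1 <;> rcases le_total b c with h2 | h2 <;>
    simp only [min_eq_left, min_eq_right, h1, h2]
  · exact min_le_left _ _
  · exact (min_le_right _ _).trans (by linarith)
  · exact (min_le_right _ _).trans (by linarith)
  · exact (min_le_right _ _).trans (by linarith)

theorem ofReal_le_of_two_le {a b x : ℝ} {R : ℝ≥0∞} (ha : ENNReal.ofReal a ≤ R)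
    (hb : ENNReal.ofReal b ≤ R) (hx : x ≤ max a b) : ENNReal.ofReal x ≤ R := by
  refine (ENNReal.ofReal_le_ofReal hx).trans ?_
  rw [ENNReal.ofReal_max]
  exact max_le ha hb

theorem covMinimaxRisk_ge (hk : 2 ≤ k) (hr : 1 ≤ r) (hrk : r ≤ k) (hkp : k ≤ p) (hn : 1 ≤ n)
    (hlam : 0 < lam) :
    ENNReal.ofReal (1 / 40000 * min
      ((lam + 1) * (k : ℝ) / (n : ℝ) * Real.log (Real.exp 1 * (p : ℝ) / (k : ℝ))
        + lam ^ 2 * (r : ℝ) / (n : ℝ)) (lam ^ 2)) ≤ covMinimaxRisk n k p r lam := by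
  have hn0 : (0 : ℝ) < n := by exact_mod_cast hn
  have hk0 : (0 : ℝ) < k := by exact_mod_cast (by omega : 0 < k)
  have hrk' : (r : ℝ) ≤ k := by exact_mod_cast hrk
  have hlog : 1 ≤ Real.log (Real.exp 1 * (p : ℝ) / (k : ℝ)) := by
    have hkp' : (1 : ℝ) ≤ p / k := by
      rw [one_le_div hk0]
      exact_mod_cast hkp
    rw [mul_div_assoc, Real.log_mul (Real.exp_ne_zero 1) (by positivity), Real.log_exp]
    linarith [Real.log_nonneg hkp']
  have hdir := covMinimaxRisk_ge_direction hk hr hrk hkp hn hlam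
  set X := (lam + 1) * (k : ℝ) / (n : ℝ) * Real.log (Real.exp 1 * (p : ℝ) / (k : ℝ))
  set Y := lam ^ 2 * (r : ℝ) / (n : ℝ) with hY
  have hX0 : 0 ≤ X := by positivity
  have hY0 : 0 ≤ Y := by positivity
  have hsplit := min_add_le_min_add_min hX0 hY0 (sq_nonneg lam)
  have hA0 : 0 ≤ min X (lam ^ 2) := le_min hX0 (sq_nonneg _)
  have hB0 : 0 ≤ min Y (lam ^ 2) := le_min hY0 (sq_nonneg _)
  -- For `lam ≤ 1`, `lam ^ 2 * r ≤ (lam + 1) * k` and the logarithm is at least `1`, so the sparse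
  -- term alone suffices.
  rcases le_total lam 1 with hl | hl
  · have hYX : Y ≤ X := by
      calc Y ≤ 1 * (lam + 1) * (k : ℝ) / n := by
            rw [hY]
            gcongr
            nlinarith
        _ = (lam + 1) * (k : ℝ) / n * 1 := by ring
        _ ≤ X := mul_le_mul_of_nonneg_left hlog (by positivity)
    refine le_trans (ENNReal.ofReal_le_ofReal ?_) hdir
    have : min Y (lam ^ 2) ≤ min X (lam ^ 2) := min_le_min hYX le_rfl
    linarith
  · have hspec : ENNReal.ofReal (1 / 32000 * min Y (lam ^ 2)) ≤ covMinimaxRisk n k p r lam := by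
      rcases hr.eq_or_lt with rfl | hr2
      · refine le_trans (ENNReal.ofReal_le_ofReal ?_) (covMinimaxRisk_ge_scale hr hrk hkp hn hlam)
        have h1 : min Y (lam ^ 2) ≤ min ((1 + lam) ^ 2 / n) (lam ^ 2) := by
          refine min_le_min ?_ le_rfl
          rw [hY, Nat.cast_one, mul_one]
          gcongr
          linarith
        linarith
      · exact covMinimaxRisk_ge_shear hr2 hrk hkp hn hl
    refine ofReal_le_of_two_le hdir hspec ?_
    rcases le_total (1 / 2000 * min X (lam ^ 2)) (1 / 32000 * min Y (lam ^ 2)) with h | h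
    · rw [max_eq_right h]
      linarith
    · rw [max_eq_left h]
      linarith

/-- Write `log (e * p) = 1 + log p`. The `1` joins `lam ^ 2` in the scale bound, as `1 + lam ^ 2 ≤
(1 + lam) ^ 2`, and `log p` comes from the position bound, which is void for `p = 1`. -/
theorem covMinimaxRisk_one_ge (hp : 1 ≤ p) (hn : 1 ≤ n) (hlam : 0 < lam) :
    ENNReal.ofReal (1 / 40000 * min
      (1 / (n : ℝ) * Real.log (Real.exp 1 * (p : ℝ)) + lam ^ 2 / (n : ℝ)) (lam ^ 2)) ≤
    covMinimaxRisk n 1 p 1 lam := by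
  have hn0 : (0 : ℝ) < n := by exact_mod_cast hn
  have hp0 : (0 : ℝ) < p := by exact_mod_cast hp
  have hscale := covMinimaxRisk_ge_scale (p := p) le_rfl le_rfl hp hn hlam
  have hpos : ENNReal.ofReal (1 / 100 * min (Real.log p / n) (lam ^ 2)) ≤
      covMinimaxRisk n 1 p 1 lam := by
    rcases hp.eq_or_lt with rfl | hp2
    · simp [sq_nonneg]
    · exact covMinimaxRisk_ge_position hp2 hn hlam
  have hlog : 0 ≤ Real.log p := Real.log_natCast_nonneg p
  set A := min ((1 + lam) ^ 2 / n) (lam ^ 2)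
  set B := min (Real.log p / n) (lam ^ 2)
  have hA0 : 0 ≤ A := le_min (by positivity) (sq_nonneg _)
  have hB0 : 0 ≤ B := le_min (by positivity) (sq_nonneg _)
  have hsplit : min (1 / (n : ℝ) * Real.log (Real.exp 1 * (p : ℝ)) + lam ^ 2 / (n : ℝ)) (lam ^ 2) ≤
      A + B := by
    refine le_trans (min_le_min ?_ le_rfl)
      (min_add_le_min_add_min (by positivity) (by positivity) (sq_nonneg lam))
    rw [Real.log_mul (Real.exp_ne_zero 1) hp0.ne', Real.log_exp, one_div, inv_mul_eq_div,
      ← add_div, ← add_div]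
    exact div_le_div_of_nonneg_right (by nlinarith) hn0.le
  refine ofReal_le_of_two_le hscale hpos ?_
  rcases le_total (1 / 360 * A) (1 / 100 * B) with h | h
  · rw [max_eq_right h]
    linarith
  · rw [max_eq_left h]
    linarith

end Minimax

end SpikedCov

end

theorem theorem4 :
    ∃ c : ℝ, 0 < c ∧
      ∀ (k p r n : ℕ) (lam : ℝ), 1 ≤ r → r ≤ k → k ≤ p → 1 ≤ n → 0 < lam →
        (2 ≤ k →
          ENNReal.ofReal (c * min
            ((lam + 1) * (k : ℝ) / (n : ℝ) * Real.log (Real.exp 1 * (p : ℝ) / (k : ℝ))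
              + lam ^ 2 * (r : ℝ) / (n : ℝ))
            (lam ^ 2))
          ≤ SpikedCov.covMinimaxRisk n k p r lam) ∧
        (k = 1 →
          ENNReal.ofReal (c * min
            (1 / (n : ℝ) * Real.log (Real.exp 1 * (p : ℝ)) + lam ^ 2 / (n : ℝ))
            (lam ^ 2))
          ≤ SpikedCov.covMinimaxRisk n k p r lam) ∧
        (∀ τ : ℝ, 1 ≤ τ →
          ENNReal.ofReal (c * min
            ((lam + 1) * ((k : ℝ) - (r : ℝ)) / ((n : ℝ) * lam ^ 2)
              * Real.log (Real.exp 1 * ((p : ℝ) - (r : ℝ)) / ((k : ℝ) - (r : ℝ))))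
            1)
          ≤ SpikedCov.subspaceMinimaxRisk n k p r lam τ) := by
  refine ⟨1 / 40000, by norm_num, fun k p r n lam hr hrk hkp hn hlam => ⟨fun hk => ?_, ?_, ?_⟩⟩
  · exact SpikedCov.covMinimaxRisk_ge hk hr hrk hkp hn hlam
  · rintro rfl
    obtain rfl : r = 1 := le_antisymm hrk hr
    exact SpikedCov.covMinimaxRisk_one_ge hkp hn hlam
  · intro τ hτ
    refine le_trans (ENNReal.ofReal_le_ofReal ?_)
      (SpikedCov.subspaceMinimaxRisk_ge hr hrk hkp hn hlam hτ)
    refine mul_le_mul_of_nonneg_right (by norm_num) (le_min ?_ zero_le_one)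
    have hrk' : (0 : ℝ) ≤ (k : ℝ) - r := sub_nonneg.mpr (by exact_mod_cast hrk)
    have hkp' : (k : ℝ) - r ≤ (p : ℝ) - r := sub_le_sub_right (by exact_mod_cast hkp) _
    refine mul_nonneg (by positivity) ?_
    rcases hrk'.eq_or_lt with h | h
    -- For `k = r`, division by zero makes the argument of the logarithm zero, and `log 0 = 0`.
    · simp [← h]
    · refine Real.log_nonneg ?_
      rw [one_le_div h]
      nlinarith [Real.add_one_le_exp (1 : ℝ)]
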